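/- **Setting.** Let $\mathbb K$ be a field of characteristic $0$ and $L$ a Leibniz algebra over $\mathbb K$, i.e. $[x,[y,z]]=[[x,y],z]-[[x,z],y]$, with $\dim\mathbb H<\infty$ for $\mathbb H=HL^2(L;L)$. On the Leibniz complex $(CL^*(L;L),\delta)$, $CL^n(L;L)=\mathrm{Hom}(L^{\otimes n},L)$, write $d\alpha=(-1)^n\delta\alpha$ for $\alpha\in CL^n(L;L)$, and let $\nu$ be the graded Lie bracket; for $\alpha,\beta\in CL^2(L;L)$ it is $\nu(\alpha,\beta)=\alpha\circ\beta+\beta\circ\alpha$ with $(\alpha\circ\beta)(x,y,z)=\alpha(\beta(x,y),z)-\alpha(\beta(x,z),y)-\alpha(x,\beta(y,z))$. A prime denotes the dual space. A deformation of $L$ with base an augmented commutative algebra $(A,\varepsilon)$ is an $A$-Leibniz algebra structure on $A\otimes L$ for which $\varepsilon\otimes \mathrm{id}$ is a homomorphism to $L$. **The construction.** Choose a linear map $\mu:\mathbb H\to CL^2(L;L)$ taking each class to a representing cocycle. Let $C_1=\mathbb K\oplus\mathbb H'$ with $\mathbb H'\cdot\mathbb H'=0$, and let $\eta_1$ be the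 deformation with base $C_1$ given by $[1\otimes x,1\otimes y]_{\eta_1}=1\otimes[x,y]+\sum_i g_i\otimes\mu(h_i)(x,y)$, where $(h_i)$ is a basis of $\mathbb H$ and $(g_i)$ its dual basis. Given a finite dimensional local algebra $C_k$ with a deformation $\eta_k$ of base $C_k$, choose a linear map taking each class $h\in H^2_{Harr}(C_k;\mathbb K)$ to a representing Harrison cocycle $f_h$; let $f(a,b)\in H^2_{Harr}(C_k;\mathbb K)'$ be $h\mapsto f_h(a,b)$ and let $$0\to H^2_{Harr}(C_k;\mathbb K)'\xrightarrow{\ \bar i_{k+1}\ }\bar C_{k+1}\xrightarrow{\ \bar p_{k+1}\ }C_k\to0$$ be the extension $\bar C_{k+1}=C_k\oplus H^2_{Harr}(C_k;\mathbb K)'$ with product $(a,m)(b,n)=(ab,\ \varepsilon(a)n+\varepsilon(b)m+f(a,b))$. Lift the bracket of $\eta_k$ to any $\bar C_{k+1}$-bilinear operation $\{\,,\}$ on $\bar C_{k+1}\otimes L$. The elements $$\{\{1\otimes x,1\otimes y\},1\otimes z\}-\{\{1\otimes x,1\otimes z\},1\otimes y\}-\{1\otimes x,\{1\otimes y,1\otimes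 z\}\}$$ lie in $H^2_{Harr}(C_k;\mathbb K)'\otimes L$; evaluated at $h\in H^2_{Harr}(C_k;\mathbb K)$ they form a $3$-cocycle of $L$, whose class is $\omega_k(h)$. This defines the obstruction $\omega_k:H^2_{Harr}(C_k;\mathbb K)\to HL^3(L;L)$ of $\eta_k$. Put $C_{k+1}=\bar C_{k+1}/\bar i_{k+1}\omega_k'(HL^3(L;L)')$, let $p_{k+1}:C_{k+1}\to C_k$ be the induced projection, and choose a deformation $\eta_{k+1}$ with base $C_{k+1}$ such that $(p_{k+1})_*\eta_{k+1}=\eta_k$. **Massey brackets.** Let $F$ be a cocommutative coassociative coalgebra (in degree $0$) with subspaces $F_0\subset F_1\subset F$ such that $F_0\subset\ker\Delta$ and $\mathrm{Im}\,\Delta\subset F_1\otimes F_1$, and let $c\in\mathbb K$. For linear maps $a:F_0\to HL^2(L;L)$ and $b:F/F_1\to HL^3(L;L)$ write $b\in[a]_F^{c}$ if there is a linear map $\alpha:F_1\to CL^2(L;L)$ with $d\alpha=c\,\nu\circ(\alpha\otimes\alpha)\circ\Delta$ on $F_1$ such that $\alpha|_{F_0}$ takes values in cocycles and induces $a$, and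 $\nu\circ(\alpha\otimes\alpha)\circ\Delta$ takes values in cocycles on $F$ and induces $b$. Write $[a]_F=[a]_F^{1/2}$, the normalisation for which the condition on $\alpha$ is the Leibniz identity of the corresponding deformation. **Theorem.** Let $k\ge1$, let $C_k,\eta_k,\bar C_{k+1}$ arise from the construction (for any choices), and let $\mathfrak M_1,\mathfrak M_k,\bar{\mathfrak M}_{k+1}$ be the maximal ideals of $C_1,C_k,\bar C_{k+1}$. Let $F=(\bar{\mathfrak M}_{k+1})'$, with the comultiplication dual to the multiplication of $\bar{\mathfrak M}_{k+1}$, $F_1=\mathfrak M_k'$ and $F_0=\mathfrak M_1'$, and identify $F_0=\mathbb H$ and $F/F_1=H^2_{Harr}(C_k;\mathbb K)$. Then $$2\omega_k\in[\mathrm{id}]_F .$$ Conversely, every element of $[\mathrm{id}]_F$ equals $2\omega$, where $\omega$ is the obstruction of some deformation $\eta$ of $L$ with base $C_k$ whose push-out to $C_1$ is $\eta_1$. Equivalently, with the defining equation $d\alpha=\nu\circ(\alpha\otimes\alpha)\circ\Delta$: $\tfrac12\omega_k\in[\tfrac12\,\mathrm{id}]_F^{1}$, and every element of $[\tfrac12\,\mathrm{id}]_F^{1}$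 equals $\tfrac12\omega$ for the obstruction $\omega$ of such a deformation $\eta$. -/

import Mathlib

set_option maxSynthPendingDepth 3

open TensorProduct

universe u v w

noncomputable section

namespace LeibnizDeformation

/-- A Leibniz algebra structure over the commutative ring `R` on the `R`-module `V`: an
`R`-bilinear bracket with `[x,[y,z]] = [[x,y],z] - [[x,z],y]`. -/
@[ext]
structure LeibnizStr (R : Type*) (V : Type*) [CommRing R] [AddCommGroup V] [Module R V] where
  br : V →ₗ[R] V →ₗ[R] V
  leibniz : ∀ x y z, br x (br y z) = br (br x y) z - br (br x z) y

section Cochains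

variable {K : Type u} [Field K] {L : Type v} [AddCommGroup L] [Module K L]

variable (K L) in
/-- `CL¹(L;L) = Hom(L, L)`. -/
abbrev CL1 := L →ₗ[K] L

variable (K L) in
/-- `CL²(L;L) = Hom(L ⊗ L, L)`, in curried form. -/
abbrev CL2 := L →ₗ[K] L →ₗ[K] L

variable (K L) in
/-- `CL³(L;L) = Hom(L ⊗ L ⊗ L, L)`, in curried form. -/
abbrev CL3 := L →ₗ[K] L →ₗ[K] L →ₗ[K] L

variable (K L) in
/-- `CL⁴(L;L) = Hom(L ⊗ L ⊗ L ⊗ L, L)`, in curried form. -/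
abbrev CL4 := L →ₗ[K] L →ₗ[K] L →ₗ[K] L →ₗ[K] L

/-- A function of three variables that is linear in each of them, as a curried linear map. -/
def mk3 {V W : Type*} [AddCommGroup V] [Module K V] [AddCommGroup W] [Module K W]
    (f : V → V → V → W)
    (a1 : ∀ x x' y z, f (x + x') y z = f x y z + f x' y z)
    (s1 : ∀ (c : K) x y z, f (c • x) y z = c • f x y z)
    (a2 : ∀ x y y' z, f x (y + y') z = f x y z + f x y' z)
    (s2 : ∀ (c : K) x y z, f x (c • y) z = c • f x y z)
    (a3 : ∀ x y z z', f x y (z + z') = f x y z + f x y z')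
    (s3 : ∀ (c : K) x y z, f x y (c • z) = c • f x y z) :
    V →ₗ[K] V →ₗ[K] V →ₗ[K] W where
  toFun x := LinearMap.mk₂ K (f x) (a2 x) (fun c => s2 c x) (a3 x) (fun c => s3 c x)
  map_add' x x' := by ext y z; exact a1 x x' y z
  map_smul' c x := by ext y z; exact s1 c x y z

/-- A function of five variables that is linear in each of them, as a curried linear map. -/
def mk5 {U V W : Type*} [AddCommGroup U] [Module K U] [AddCommGroup V] [Module K V]
    [AddCommGroup W] [Module K W] (f : U → V → V → V → V → W)
    (a0 : ∀ u u' x y z t, f (u + u') x y z t = f u x y z t + f u' x y z t)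
    (s0 : ∀ (c : K) u x y z t, f (c • u) x y z t = c • f u x y z t)
    (a1 : ∀ u x x' y z t, f u (x + x') y z t = f u x y z t + f u x' y z t)
    (s1 : ∀ (c : K) u x y z t, f u (c • x) y z t = c • f u x y z t)
    (a2 : ∀ u x y y' z t, f u x (y + y') z t = f u x y z t + f u x y' z t)
    (s2 : ∀ (c : K) u x y z t, f u x (c • y) z t = c • f u x y z t)
    (a3 : ∀ u x y z z' t, f u x y (z + z') t = f u x y z t + f u x y z' t)
    (s3 : ∀ (c : K) u x y z t, f u x y (c • z) t = c • f u x y z t)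
    (a4 : ∀ u x y z t t', f u x y z (t + t') = f u x y z t + f u x y z t')
    (s4 : ∀ (c : K) u x y z t, f u x y z (c • t) = c • f u x y z t) :
    U →ₗ[K] V →ₗ[K] V →ₗ[K] V →ₗ[K] V →ₗ[K] W where
  toFun u :=
    { toFun := fun x => mk3 (f u x) (a2 u x) (fun c => s2 c u x) (a3 u x) (fun c => s3 c u x)
        (a4 u x) (fun c => s4 c u x)
      map_add' := fun x x' => by ext y z t; exact a1 u x x' y z t
      map_smul' := fun c x => by ext y z t; exact s1 c u x y z t }
  map_add' u u' := by ext x y z t; exact a0 u u' x y z t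
  map_smul' c u := by ext x y z t; exact s0 c u x y z t

/-- The Leibniz coboundary `δ¹ : CL¹(L;L) → CL²(L;L)`,
`δf(x,y) = [x,f(y)] + [f(x),y] - f([x,y])`. -/
def δ1 (ℓ : LeibnizStr K L) : CL1 K L →ₗ[K] CL2 K L where
  toFun f := LinearMap.mk₂ K (fun x y => ℓ.br x (f y) + ℓ.br (f x) y - f (ℓ.br x y))
    (by intros; simp; abel) (by intros; simp [smul_sub, smul_add])
    (by intros; simp; abel) (by intros; simp [smul_sub, smul_add])
  map_add' f g := by ext; simp; abel
  map_smul' c f := by ext; simp [smul_sub, smul_add]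

/-- The Leibniz coboundary `δ² : CL²(L;L) → CL³(L;L)`: the case `n = 2` of
`δⁿf(x₁,…,xₙ₊₁) = [x₁,f(x₂,…,xₙ₊₁)] + ∑_{i ≥ 2} (-1)ⁱ [f(x₁,…,x̂ᵢ,…,xₙ₊₁),xᵢ]
  + ∑_{i < j} (-1)ʲ⁺¹ f(x₁,…,xᵢ₋₁,[xᵢ,xⱼ],xᵢ₊₁,…,x̂ⱼ,…,xₙ₊₁)`. -/
def δ2 (ℓ : LeibnizStr K L) : CL2 K L →ₗ[K] CL3 K L where
  toFun f := mk3 (fun x y z =>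
      ℓ.br x (f y z) + ℓ.br (f x z) y - ℓ.br (f x y) z
        - f (ℓ.br x y) z + f (ℓ.br x z) y + f x (ℓ.br y z))
    (by intros; simp; abel) (by intros; simp [smul_sub, smul_add])
    (by intros; simp; abel) (by intros; simp [smul_sub, smul_add])
    (by intros; simp; abel) (by intros; simp [smul_sub, smul_add])
  map_add' f g := by ext; simp [mk3]; abel
  map_smul' c f := by ext; simp [mk3, smul_sub, smul_add]

/-- The value of `δ³f`: the case `n = 3` of the formula above. -/
def δ3Fun (ℓ : LeibnizStr K L) (f : CL3 K L) (x y z t : L) : L :=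
  ℓ.br x (f y z t) + ℓ.br (f x z t) y - ℓ.br (f x y t) z + ℓ.br (f x y z) t
    - f (ℓ.br x y) z t + f (ℓ.br x z) y t + f x (ℓ.br y z) t
    - f (ℓ.br x t) y z - f x (ℓ.br y t) z - f x y (ℓ.br z t)

/-- The Leibniz coboundary `δ³ : CL³(L;L) → CL⁴(L;L)`. -/
def δ3 (ℓ : LeibnizStr K L) : CL3 K L →ₗ[K] CL4 K L :=
  mk5 (δ3Fun ℓ)
    (by intros; simp only [δ3Fun, map_add, LinearMap.add_apply]; abel)
    (by intros; simp only [δ3Fun, map_smul, LinearMap.smul_apply, smul_sub, smul_add])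
    (by intros; simp only [δ3Fun, map_add, LinearMap.add_apply]; abel)
    (by intros; simp only [δ3Fun, map_smul, LinearMap.smul_apply, smul_sub, smul_add])
    (by intros; simp only [δ3Fun, map_add, LinearMap.add_apply]; abel)
    (by intros; simp only [δ3Fun, map_smul, LinearMap.smul_apply, smul_sub, smul_add])
    (by intros; simp only [δ3Fun, map_add, LinearMap.add_apply]; abel)
    (by intros; simp only [δ3Fun, map_smul, LinearMap.smul_apply, smul_sub, smul_add])
    (by intros; simp only [δ3Fun, map_add, LinearMap.add_apply]; abel)
    (by intros; simp only [δ3Fun, map_smul, LinearMap.smul_apply, smul_sub, smul_add])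

theorem δ1_apply (ℓ : LeibnizStr K L) (f : CL1 K L) (x y : L) :
    δ1 ℓ f x y = ℓ.br x (f y) + ℓ.br (f x) y - f (ℓ.br x y) := rfl

theorem δ2_apply (ℓ : LeibnizStr K L) (f : CL2 K L) (x y z : L) :
    δ2 ℓ f x y z = ℓ.br x (f y z) + ℓ.br (f x z) y - ℓ.br (f x y) z
        - f (ℓ.br x y) z + f (ℓ.br x z) y + f x (ℓ.br y z) := rfl

theorem δ3_apply (ℓ : LeibnizStr K L) (f : CL3 K L) (x y z t : L) :
    δ3 ℓ f x y z t =
      ℓ.br x (f y z t) + ℓ.br (f x z t) y - ℓ.br (f x y t) z + ℓ.br (f x y z) t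
          - f (ℓ.br x y) z t + f (ℓ.br x z) y t + f x (ℓ.br y z) t
          - f (ℓ.br x t) y z - f x (ℓ.br y t) z - f x y (ℓ.br z t) := rfl

theorem δ2_comp_δ1 (ℓ : LeibnizStr K L) : δ2 ℓ ∘ₗ δ1 ℓ = 0 := by
  ext f x y z
  simp only [LinearMap.comp_apply, δ2_apply, δ1_apply, map_add, map_sub, LinearMap.add_apply,
    LinearMap.sub_apply, ℓ.leibniz, LinearMap.zero_apply]
  abel

theorem δ3_comp_δ2 (ℓ : LeibnizStr K L) : δ3 ℓ ∘ₗ δ2 ℓ = 0 := by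
  ext f x y z t
  simp only [LinearMap.comp_apply, δ2_apply, δ3_apply, map_add, map_sub, LinearMap.add_apply,
    LinearMap.sub_apply, ℓ.leibniz, LinearMap.zero_apply]
  abel

/-- The second Leibniz cohomology `HL²(L;L) = ker δ² / im δ¹`. -/
def HL2 (ℓ : LeibnizStr K L) :=
  LinearMap.ker (δ2 ℓ) ⧸ (LinearMap.range (δ1 ℓ)).submoduleOf (LinearMap.ker (δ2 ℓ))

instance (ℓ : LeibnizStr K L) : AddCommGroup (HL2 ℓ) :=
  inferInstanceAs (AddCommGroup (_ ⧸ (LinearMap.range (δ1 ℓ)).submoduleOf (LinearMap.ker (δ2 ℓ))))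

instance (ℓ : LeibnizStr K L) : Module K (HL2 ℓ) :=
  inferInstanceAs (Module K (_ ⧸ (LinearMap.range (δ1 ℓ)).submoduleOf (LinearMap.ker (δ2 ℓ))))

/-- The third Leibniz cohomology `HL³(L;L) = ker δ³ / im δ²`. -/
def HL3 (ℓ : LeibnizStr K L) :=
  LinearMap.ker (δ3 ℓ) ⧸ (LinearMap.range (δ2 ℓ)).submoduleOf (LinearMap.ker (δ3 ℓ))

instance (ℓ : LeibnizStr K L) : AddCommGroup (HL3 ℓ) :=
  inferInstanceAs (AddCommGroup (_ ⧸ (LinearMap.range (δ2 ℓ)).submoduleOf (LinearMap.ker (δ3 ℓ))))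

instance (ℓ : LeibnizStr K L) : Module K (HL3 ℓ) :=
  inferInstanceAs (Module K (_ ⧸ (LinearMap.range (δ2 ℓ)).submoduleOf (LinearMap.ker (δ3 ℓ))))

/-- The class in `HL²(L;L)` of a cocycle. -/
def HL2.mk (ℓ : LeibnizStr K L) : LinearMap.ker (δ2 ℓ) →ₗ[K] HL2 ℓ := Submodule.mkQ _

/-- The class in `HL³(L;L)` of a cocycle. -/
def HL3.mk (ℓ : LeibnizStr K L) : LinearMap.ker (δ3 ℓ) →ₗ[K] HL3 ℓ := Submodule.mkQ _

/-- The composition product of two 2-cochains: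
`(α∘β)(x,y,z) = α(β(x,y),z) - α(β(x,z),y) - α(x,β(y,z))`. -/
def circ (α β : CL2 K L) : CL3 K L :=
  mk3 (fun x y z => α (β x y) z - α (β x z) y - α x (β y z))
    (by intros; simp; abel) (by intros; simp [smul_sub])
    (by intros; simp; abel) (by intros; simp [smul_sub])
    (by intros; simp; abel) (by intros; simp [smul_sub])

theorem circ_apply (α β : CL2 K L) (x y z : L) :
    circ α β x y z = α (β x y) z - α (β x z) y - α x (β y z) := rfl

variable (K L) in
/-- The graded Lie bracket `ν` of `CL*(L;L)` on 2-cochains, `[α,β] = α∘β + β∘α`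
(the case `p = q = 1` of `[α,β] = α∘β + (-1)^{pq+1} β∘α`). -/
def nu : CL2 K L →ₗ[K] CL2 K L →ₗ[K] CL3 K L :=
  LinearMap.mk₂ K (fun α β => circ α β + circ β α)
    (by intros; ext; simp [circ_apply]; abel)
    (by intros; ext; simp [circ_apply, smul_sub])
    (by intros; ext; simp [circ_apply]; abel)
    (by intros; ext; simp [circ_apply, smul_sub])

/-- The differential `dα = (-1)^{|α|} δα` of the differential graded Lie algebra `CL*(L;L)` on
`CL²(L;L)`, where `|α| = n` for `α ∈ CLⁿ(L;L)`. -/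
def d2 (ℓ : LeibnizStr K L) : CL2 K L →ₗ[K] CL3 K L := (-1 : K) ^ 2 • δ2 ℓ

/-- A linear map `μ : HL²(L;L) → CL²(L;L)` that takes every class to a cocycle representing it. -/
structure HL2Section (ℓ : LeibnizStr K L) where
  toFun : HL2 ℓ →ₗ[K] LinearMap.ker (δ2 ℓ)
  mk_toFun : ∀ h, HL2.mk ℓ (toFun h) = h

end Cochains

section Harrison

variable {K : Type u} [Field K] {A : Type w} [CommRing A] [Algebra K A]

/-- The Harrison coboundary `Hom(A, K) → Hom(A ⊗ A, K)` with coefficients in `K`, on which `A`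
acts through the augmentation `ε`. -/
def harrδ (ε : A →ₐ[K] K) : (A →ₗ[K] K) →ₗ[K] A →ₗ[K] A →ₗ[K] K where
  toFun g := LinearMap.mk₂ K (fun a b => ε a * g b - g (a * b) + ε b * g a)
    (by intros; simp [add_mul, mul_add]; ring) (by intros; simp; ring)
    (by intros; simp [add_mul, mul_add]; ring) (by intros; simp; ring)
  map_add' f g := by ext; simp; ring
  map_smul' c f := by ext; simp; ring

/-- Harrison 2-cocycles of `A` with coefficients in `K`. Modulo shuffles, a 2-cochain is a
symmetric bilinear form on `A`. -/
def HarrZ2 (ε : A →ₐ[K] K) : Submodule K (A →ₗ[K] A →ₗ[K] K) where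
  carrier := {f | (∀ a b, f a b = f b a) ∧
    ∀ a b c, ε a * f b c - f (a * b) c + f a (b * c) - ε c * f a b = 0}
  zero_mem' := by simp
  add_mem' := by
    rintro f g ⟨hf, hf'⟩ ⟨hg, hg'⟩
    refine ⟨fun a b => by simp [hf a b, hg a b], fun a b c => ?_⟩
    simp only [LinearMap.add_apply]
    linear_combination hf' a b c + hg' a b c
  smul_mem' := by
    rintro c f ⟨hf, hf'⟩
    refine ⟨fun a b => by simp [hf a b], fun x y z => ?_⟩
    simp only [LinearMap.smul_apply, smul_eq_mul]
    linear_combination c * hf' x y z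

theorem range_harrδ_le (ε : A →ₐ[K] K) : LinearMap.range (harrδ ε) ≤ HarrZ2 ε := by
  rintro _ ⟨g, rfl⟩
  refine ⟨fun a b => ?_, fun a b c => ?_⟩
  · simp only [harrδ, LinearMap.coe_mk, AddHom.coe_mk, LinearMap.mk₂_apply, mul_comm a b]; ring
  · simp only [harrδ, LinearMap.coe_mk, AddHom.coe_mk, LinearMap.mk₂_apply, map_mul, mul_assoc]
    ring

/-- The second Harrison cohomology `H²_Harr(A;K)`. -/
def H2Harr (ε : A →ₐ[K] K) :=
  HarrZ2 ε ⧸ (LinearMap.range (harrδ ε)).submoduleOf (HarrZ2 ε)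

instance (ε : A →ₐ[K] K) : AddCommGroup (H2Harr ε) :=
  inferInstanceAs (AddCommGroup (_ ⧸ (LinearMap.range (harrδ ε)).submoduleOf (HarrZ2 ε)))

instance (ε : A →ₐ[K] K) : Module K (H2Harr ε) :=
  inferInstanceAs (Module K (_ ⧸ (LinearMap.range (harrδ ε)).submoduleOf (HarrZ2 ε)))

instance (ε : A →ₐ[K] K) [Module.Finite K A] : Module.Finite K (H2Harr ε) :=
  inferInstanceAs (Module.Finite K (_ ⧸ (LinearMap.range (harrδ ε)).submoduleOf (HarrZ2 ε)))

/-- The class in `H²_Harr(A;K)` of a cocycle. -/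
def H2Harr.mk (ε : A →ₐ[K] K) : HarrZ2 ε →ₗ[K] H2Harr ε := Submodule.mkQ _

/-- A linear map `H²_Harr(A;K) → (Ch₂(A))'` that takes every class to a cocycle representing
it. -/
structure HarrSection (ε : A →ₐ[K] K) where
  toFun : H2Harr ε →ₗ[K] HarrZ2 ε
  mk_toFun : ∀ h, H2Harr.mk ε (toFun h) = h

/-- The map `f_A : A ⊗ A → H²_Harr(A;K)'` dual to a section. -/
def HarrSection.cocycle {ε : A →ₐ[K] K} (s : HarrSection ε) :
    A →ₗ[K] A →ₗ[K] Module.Dual K (H2Harr ε) :=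
  LinearMap.mk₂ K (fun a b =>
      { toFun := fun h => (s.toFun h : A →ₗ[K] A →ₗ[K] K) a b
        map_add' := by simp
        map_smul' := by simp })
    (by intros; ext; simp) (by intros; ext; simp) (by intros; ext; simp) (by intros; ext; simp)

theorem HarrSection.cocycle_apply {ε : A →ₐ[K] K} (s : HarrSection ε) (a b : A) (h : H2Harr ε) :
    s.cocycle a b h = (s.toFun h : A →ₗ[K] A →ₗ[K] K) a b := rfl

theorem HarrSection.cocycle_comm {ε : A →ₐ[K] K} (s : HarrSection ε) (a b : A) :
    s.cocycle a b = s.cocycle b a := by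
  apply LinearMap.ext
  intro h
  exact (s.toFun h).2.1 a b

theorem HarrSection.cocycle_cocycle {ε : A →ₐ[K] K} (s : HarrSection ε) (a b c : A) :
    ε a • s.cocycle b c - s.cocycle (a * b) c + s.cocycle a (b * c) - ε c • s.cocycle a b = 0 := by
  apply LinearMap.ext
  intro h
  exact (s.toFun h).2.2 a b c

theorem HarrSection.cocycle_one {ε : A →ₐ[K] K} (s : HarrSection ε) (a : A) :
    s.cocycle 1 a = ε a • s.cocycle 1 1 := by
  have := s.cocycle_cocycle 1 1 a
  simp only [map_one, one_smul, one_mul] at this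
  rw [← sub_eq_zero, ← this]
  abel

/-- The vector space `A ⊕ H²_Harr(A;K)'` underlying the extension
`0 → H²_Harr(A;K)' → Ā → A → 0` of `A` defined by the cocycle `f_A`. -/
@[ext]
structure HarrExt {ε : A →ₐ[K] K} (s : HarrSection ε) where
  base : A
  fib : Module.Dual K (H2Harr ε)

namespace HarrExt

variable {ε : A →ₐ[K] K} (s : HarrSection ε)

/-- `Ā = A ⊕ H²_Harr(A;K)'` as a set of pairs. -/
def equivProd : HarrExt s ≃ A × Module.Dual K (H2Harr ε) where
  toFun x := (x.base, x.fib)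
  invFun x := ⟨x.1, x.2⟩
  left_inv _ := rfl
  right_inv _ := rfl

instance : AddCommGroup (HarrExt s) := (equivProd s).addCommGroup

instance : Module K (HarrExt s) := (equivProd s).module K

variable {s}

@[simp] theorem base_add (x y : HarrExt s) : (x + y).base = x.base + y.base := rfl
@[simp] theorem fib_add (x y : HarrExt s) : (x + y).fib = x.fib + y.fib := rfl
@[simp] theorem base_zero : (0 : HarrExt s).base = 0 := rfl
@[simp] theorem fib_zero : (0 : HarrExt s).fib = 0 := rfl
@[simp] theorem base_smul (c : K) (x : HarrExt s) : (c • x).base = c • x.base := rfl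
@[simp] theorem fib_smul (c : K) (x : HarrExt s) : (c • x).fib = c • x.fib := rfl

/-- The multiplication `(a,m)(b,n) = (ab, a n + b m + f_A(a,b))`. -/
instance : Mul (HarrExt s) :=
  ⟨fun x y => ⟨x.base * y.base, ε x.base • y.fib + ε y.base • x.fib + s.cocycle x.base y.base⟩⟩

/-- The unit `(1, -f_A(1,1))`. -/
instance : One (HarrExt s) := ⟨⟨1, -s.cocycle 1 1⟩⟩

@[simp] theorem base_mul (x y : HarrExt s) : (x * y).base = x.base * y.base := rfl
@[simp] theorem fib_mul (x y : HarrExt s) :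
    (x * y).fib = ε x.base • y.fib + ε y.base • x.fib + s.cocycle x.base y.base := rfl
@[simp] theorem base_one : (1 : HarrExt s).base = 1 := rfl
@[simp] theorem fib_one : (1 : HarrExt s).fib = -s.cocycle 1 1 := rfl

theorem mul_comm' (x y : HarrExt s) : x * y = y * x := by
  ext1
  · simp [mul_comm]
  · simp only [fib_mul, s.cocycle_comm x.base y.base]; abel

theorem one_mul' (x : HarrExt s) : 1 * x = x := by
  ext1
  · simp
  · simp only [fib_mul, base_one, fib_one, map_one, one_smul, s.cocycle_one x.base, smul_neg]
    abel

theorem mul_assoc' (x y z : HarrExt s) : x * y * z = x * (y * z) := by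
  ext1
  · simp [mul_assoc]
  · have h := s.cocycle_cocycle x.base y.base z.base
    simp only [fib_mul, base_mul, map_mul, smul_add, smul_smul, mul_comm (ε z.base)]
    rw [← sub_eq_zero, ← neg_eq_zero, ← h]
    abel

theorem left_distrib' (x y z : HarrExt s) : x * (y + z) = x * y + x * z := by
  ext1
  · simp [mul_add]
  · simp only [fib_mul, base_add, fib_add, map_add, smul_add, add_smul]; abel

theorem mul_zero' (x : HarrExt s) : x * 0 = 0 := by
  ext1 <;> simp

instance : CommRing (HarrExt s) where
  __ := (inferInstance : AddCommGroup (HarrExt s))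
  mul_assoc := mul_assoc'
  mul_comm := mul_comm'
  one_mul := one_mul'
  mul_one x := by rw [mul_comm', one_mul']
  left_distrib := left_distrib'
  right_distrib x y z := by rw [mul_comm', left_distrib', mul_comm' z x, mul_comm' z y]
  zero_mul x := by rw [mul_comm', mul_zero']
  mul_zero := mul_zero'

instance : Algebra K (HarrExt s) :=
  Algebra.ofModule
    (by
      intro c x y
      ext1
      · simp
      · simp only [fib_mul, base_smul, fib_smul, map_smul, smul_eq_mul, smul_add, smul_smul,
          LinearMap.smul_apply, mul_comm c])
    (by
      intro c x y
      ext1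
      · simp
      · simp only [fib_mul, base_smul, fib_smul, map_smul, smul_eq_mul, smul_add, smul_smul,
          mul_comm c])

variable (s)

/-- The projection `p̄ : Ā → A`. -/
def proj : HarrExt s →ₐ[K] A :=
  AlgHom.ofLinearMap
    { toFun := base, map_add' := base_add, map_smul' := base_smul } rfl (fun _ _ => rfl)

/-- The inclusion `ī : H²_Harr(A;K)' → Ā`. -/
def incl : Module.Dual K (H2Harr ε) →ₗ[K] HarrExt s where
  toFun m := ⟨0, m⟩
  map_add' _ _ := by ext1 <;> simp
  map_smul' _ _ := by ext1 <;> simp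

/-- The augmentation of `Ā`. -/
def aug : HarrExt s →ₐ[K] K := ε.comp (proj s)

theorem aug_eq : aug s = ε.comp (proj s) := rfl

@[simp] theorem proj_apply (x : HarrExt s) : proj s x = x.base := rfl
@[simp] theorem aug_apply (x : HarrExt s) : aug s x = ε x.base := rfl
@[simp] theorem base_incl (m : Module.Dual K (H2Harr ε)) : (incl s m).base = 0 := rfl
@[simp] theorem fib_incl (m : Module.Dual K (H2Harr ε)) : (incl s m).fib = m := rfl

theorem incl_mul (m : Module.Dual K (H2Harr ε)) (x : HarrExt s) :
    incl s m * x = incl s (aug s x • m) := by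
  ext1 <;> simp

theorem proj_surjective : Function.Surjective (proj s) := fun a => ⟨⟨a, 0⟩, rfl⟩

/-- The linear equivalence `Ā ≃ A × H²_Harr(A;K)'`. -/
def linearEquivProd : HarrExt s ≃ₗ[K] A × Module.Dual K (H2Harr ε) :=
  { equivProd s with
    map_add' := fun _ _ => rfl
    map_smul' := fun _ _ => rfl }

instance [Module.Finite K A] : Module.Finite K (HarrExt s) :=
  Module.Finite.equiv (linearEquivProd s).symm

instance [IsLocalRing A] : IsLocalRing (HarrExt s) := by
  have : IsLocalHom (proj s : HarrExt s →+* A) := ⟨by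
    intro x hx
    obtain ⟨b, hb⟩ := hx.exists_right_inv
    have hb : x.base * b = 1 := hb
    have he : ε x.base * ε b = 1 := by rw [← map_mul, hb, map_one]
    refine IsUnit.of_mul_eq_one
      ⟨b, ε b • (-s.cocycle 1 1 - ε b • x.fib - s.cocycle x.base b)⟩ ?_
    ext1
    · exact hb
    · simp only [fib_mul, fib_one, smul_smul, he, one_smul]
      abel⟩
  exact RingHom.domain_isLocalRing (proj s : HarrExt s →+* A)

end HarrExt

end Harrison

section Deformations

variable {K : Type u} [Field K] {L : Type v} [AddCommGroup L] [Module K L]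

/-- The map `ε ⊗ id : A ⊗ L → K ⊗ L = L`. -/
def augMap (L : Type v) [AddCommGroup L] [Module K L] {A : Type*} [CommRing A] [Algebra K A]
    (ε : A →ₐ[K] K) : A ⊗[K] L →ₗ[K] L :=
  (TensorProduct.lid K L).toLinearMap ∘ₗ ε.toLinearMap.rTensor L

@[simp] theorem augMap_tmul {A : Type*} [CommRing A] [Algebra K A] (ε : A →ₐ[K] K) (a : A)
    (x : L) : augMap L ε (a ⊗ₜ x) = ε a • x := by
  simp [augMap]

/-- A deformation of the Leibniz algebra `L` with base `A` (augmented by `ε`): an `A`-Leibniz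
algebra structure on `A ⊗ L` for which `ε ⊗ id` is a homomorphism. -/
@[ext]
structure Deformation (ℓ : LeibnizStr K L) {A : Type*} [CommRing A] [Algebra K A]
    (ε : A →ₐ[K] K) extends LeibnizStr A (A ⊗[K] L) where
  augMap_br : ∀ x y, augMap L ε (br x y) = ℓ.br (augMap L ε x) (augMap L ε y)

/-- `lam'` is the push-out `φ_* lam`: if `[1⊗x,1⊗y] = 1⊗[x,y] + ∑ cⱼ⊗yⱼ` in `lam`, then
`[1⊗x,1⊗y] = 1⊗[x,y] + ∑ φ(cⱼ)⊗yⱼ` in `lam'`. This determines the bracket of `lam'`. -/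
def IsPushout {ℓ : LeibnizStr K L} {A B : Type*} [CommRing A] [Algebra K A] [CommRing B]
    [Algebra K B] {ε : A →ₐ[K] K} {ε' : B →ₐ[K] K} (φ : A →ₐ[K] B)
    (lam : Deformation ℓ ε) (lam' : Deformation ℓ ε') : Prop :=
  ∀ x y : L, lam'.br (1 ⊗ₜ x) (1 ⊗ₜ y) = φ.toLinearMap.rTensor L (lam.br (1 ⊗ₜ x) (1 ⊗ₜ y))

/-- The `A`-bilinear operation on `A ⊗ L` with prescribed values on the elements `1 ⊗ x`. -/
def extBr {A : Type*} [CommRing A] [Algebra K A] (β : L →ₗ[K] L →ₗ[K] A ⊗[K] L) :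
    A ⊗[K] L →ₗ[A] A ⊗[K] L →ₗ[A] A ⊗[K] L :=
  LinearMap.liftBaseChange A
    (((LinearMap.liftBaseChangeEquiv (R := K) (M := L) (N := A ⊗[K] L) A).toLinearMap.restrictScalars
      K) ∘ₗ β)

theorem extBr_tmul {A : Type*} [CommRing A] [Algebra K A] (β : L →ₗ[K] L →ₗ[K] A ⊗[K] L)
    (a b : A) (x y : L) : extBr β (a ⊗ₜ x) (b ⊗ₜ y) = (a * b) • β x y := by
  simp [extBr, mul_smul]

/-- The expression `[[x,y],z] - [[x,z],y] - [x,[y,z]]`, which vanishes for a Leibniz bracket. -/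
def jac {R V : Type*} [CommRing R] [AddCommGroup V] [Module R V] (br : V →ₗ[R] V →ₗ[R] V)
    (x y z : V) : V :=
  br (br x y) z - br (br x z) y - br x (br y z)

/-- If `jac` vanishes on the elements `1 ⊗ x`, it vanishes. -/
theorem jac_eq_zero {A : Type*} [CommRing A] [Algebra K A]
    (br : A ⊗[K] L →ₗ[A] A ⊗[K] L →ₗ[A] A ⊗[K] L)
    (h : ∀ x y z : L, jac br (1 ⊗ₜ x) (1 ⊗ₜ y) (1 ⊗ₜ z) = 0) (u v w : A ⊗[K] L) :
    jac br u v w = 0 := by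
  have e : ∀ (a : A) (x : L), a ⊗ₜ[K] x = a • ((1 : A) ⊗ₜ[K] x) := by
    intro a x; simp [TensorProduct.smul_tmul']
  induction u with
  | zero => simp [jac]
  | add u u' hu hu' =>
    rw [← add_zero (0 : A ⊗[K] L), ← hu.trans rfl]
    nth_rw 2 [hu]
    rw [← hu']
    simp only [jac, map_add, LinearMap.add_apply]; abel
  | tmul a x =>
    induction v with
    | zero => simp [jac]
    | add u u' hu hu' =>
      have : jac br (a ⊗ₜ x) (u + u') w = jac br (a ⊗ₜ x) u w + jac br (a ⊗ₜ x) u' w := by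
        simp only [jac, map_add, LinearMap.add_apply]; abel
      rw [this, hu, hu', add_zero]
    | tmul b y =>
      induction w with
      | zero => simp [jac]
      | add u u' hu hu' =>
        have : jac br (a ⊗ₜ x) (b ⊗ₜ y) (u + u')
            = jac br (a ⊗ₜ x) (b ⊗ₜ y) u + jac br (a ⊗ₜ x) (b ⊗ₜ y) u' := by
          simp only [jac, map_add, LinearMap.add_apply]; abel
        rw [this, hu, hu', add_zero]
      | tmul c z =>
        have : jac br (a ⊗ₜ x) (b ⊗ₜ y) (c ⊗ₜ z)
            = (a * b * c) • jac br (1 ⊗ₜ x) (1 ⊗ₜ y) (1 ⊗ₜ z) := by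
          rw [e a x, e b y, e c z]
          simp only [jac, map_smul, LinearMap.smul_apply, smul_sub, smul_smul]
          ring_nf
        rw [this, h, smul_zero]

theorem augMap_smul {A : Type*} [CommRing A] [Algebra K A] (ε : A →ₐ[K] K) (c : A)
    (t : A ⊗[K] L) : augMap L ε (c • t) = ε c • augMap L ε t := by
  induction t with
  | zero => simp
  | add s t hs ht => simp only [smul_add, map_add, hs, ht]
  | tmul d z =>
    rw [TensorProduct.smul_tmul', smul_eq_mul, augMap_tmul, augMap_tmul, map_mul, mul_smul]

theorem augMap_br_of_one {ℓ : LeibnizStr K L} {A : Type*} [CommRing A] [Algebra K A]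
    (ε : A →ₐ[K] K) (br : A ⊗[K] L →ₗ[A] A ⊗[K] L →ₗ[A] A ⊗[K] L)
    (h : ∀ x y : L, augMap L ε (br (1 ⊗ₜ x) (1 ⊗ₜ y)) = ℓ.br x y) (u v : A ⊗[K] L) :
    augMap L ε (br u v) = ℓ.br (augMap L ε u) (augMap L ε v) := by
  have e : ∀ (a : A) (x : L), a ⊗ₜ[K] x = a • ((1 : A) ⊗ₜ[K] x) := by
    intro a x; simp [TensorProduct.smul_tmul']
  induction u with
  | zero => simp
  | add u u' hu hu' => simp only [map_add, LinearMap.add_apply, hu, hu']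
  | tmul a x =>
    induction v with
    | zero => simp
    | add u u' hu hu' => simp only [map_add, hu, hu']
    | tmul b y =>
      rw [e a x, e b y, LinearMap.map_smul (br _), LinearMap.map_smul br, LinearMap.smul_apply,
        augMap_smul, augMap_smul, augMap_smul, augMap_smul, h]
      simp only [augMap_tmul, map_one, one_smul, map_smul, LinearMap.smul_apply]

end Deformations

section SquareZero

variable {K : Type u} [Field K] {L : Type v} [AddCommGroup L] [Module K L]
  {H : Type w} [AddCommGroup H] [Module K H]

variable (K H) in
/-- The algebra `K ⊕ H'` in which `H'` has zero multiplication. -/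
abbrev SqZero := TrivSqZeroExt K (Module.Dual K H)

variable (K H) in
/-- The augmentation of `K ⊕ H'`. -/
abbrev augSqZero : SqZero K H →ₐ[K] K := TrivSqZeroExt.fstHom K K (Module.Dual K H)

instance : IsLocalRing (SqZero K H) := by
  have : IsLocalHom (augSqZero K H : SqZero K H →+* K) :=
    ⟨fun x hx => TrivSqZeroExt.isUnit_iff_isUnit_fst.2 hx⟩
  exact RingHom.domain_isLocalRing (augSqZero K H : SqZero K H →+* K)

variable [FiniteDimensional K H]

instance : Module.Finite K (SqZero K H) :=
  inferInstanceAs (Module.Finite K (K × Module.Dual K H))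

variable (K L H) in
/-- The inclusion `Hom(H, L) = H' ⊗ L → (K ⊕ H') ⊗ L`. -/
def homIncl : (H →ₗ[K] L) →ₗ[K] SqZero K H ⊗[K] L :=
  (TrivSqZeroExt.inrHom K (Module.Dual K H)).rTensor L ∘ₗ
    (dualTensorHomEquiv (R := K) (M := H) (N := L)).symm.toLinearMap

theorem homIncl_dualTensorHom (g : Module.Dual K H) (x : L) :
    homIncl K L H (dualTensorHom K H L (g ⊗ₜ x)) = TrivSqZeroExt.inr g ⊗ₜ x := by
  have : (dualTensorHomEquiv (R := K) (M := H) (N := L)).symm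
      (dualTensorHom K H L (g ⊗ₜ x)) = g ⊗ₜ x := by
    rw [LinearEquiv.symm_apply_eq]; rfl
  rw [homIncl, LinearMap.comp_apply, LinearEquiv.coe_coe, this]
  rfl

theorem hom_induction {P : (H →ₗ[K] L) → Prop} (f : H →ₗ[K] L) (h0 : P 0)
    (ha : ∀ f g, P f → P g → P (f + g))
    (ht : ∀ g x, P (dualTensorHom K H L (g ⊗ₜ x))) : P f := by
  obtain ⟨t, rfl⟩ := (dualTensorHom_bijective (R := K) (M := H) (N := L)).2 f
  induction t with
  | zero => simpa using h0
  | add a b h1 h2 => rw [map_add]; exact ha _ _ h1 h2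
  | tmul g x => exact ht g x

theorem augMap_homIncl (f : H →ₗ[K] L) : augMap L (augSqZero K H) (homIncl K L H f) = 0 := by
  refine hom_induction (P := fun f => augMap L (augSqZero K H) (homIncl K L H f) = 0) f
    (by rw [map_zero, map_zero])
    (fun f g hf hg => by rw [map_add, map_add, hf, hg, add_zero]) (fun g y => ?_)
  rw [homIncl_dualTensorHom, augMap_tmul, TrivSqZeroExt.fstHom_apply, TrivSqZeroExt.fst_inr,
    zero_smul]

theorem inr_smul_homIncl (g : Module.Dual K H) (f : H →ₗ[K] L) :
    (TrivSqZeroExt.inr g : SqZero K H) • homIncl K L H f = 0 := by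
  refine hom_induction (P := fun f => (TrivSqZeroExt.inr g : SqZero K H) • homIncl K L H f = 0) f
    (by rw [map_zero, smul_zero])
    (fun f g hf hg => by rw [map_add, smul_add, hf, hg, add_zero]) (fun g' z => ?_)
  rw [homIncl_dualTensorHom, TensorProduct.smul_tmul', smul_eq_mul, TrivSqZeroExt.inr_mul_inr,
    TensorProduct.zero_tmul]

/-- The `(K ⊕ H')`-bilinear operation on `(K ⊕ H') ⊗ L` with
`[1⊗x,1⊗y] = 1⊗[x,y] + (h ↦ m(x,y)(h))`, i.e. `1⊗[x,y] + ∑ᵢ gᵢ⊗m(x,y)(hᵢ)` for a basis `hᵢ` of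
`H` with dual basis `gᵢ`. -/
def sqZeroBr (ℓ : LeibnizStr K L) (m : L →ₗ[K] L →ₗ[K] (H →ₗ[K] L)) :
    SqZero K H ⊗[K] L →ₗ[SqZero K H] SqZero K H ⊗[K] L →ₗ[SqZero K H] SqZero K H ⊗[K] L :=
  extBr (ℓ.br.compr₂ (TensorProduct.mk K (SqZero K H) L 1) + m.compr₂ (homIncl K L H))

variable (ℓ : LeibnizStr K L) (m : L →ₗ[K] L →ₗ[K] (H →ₗ[K] L))

theorem sqZeroBr_tmul (a b : SqZero K H) (x y : L) :
    sqZeroBr ℓ m (a ⊗ₜ x) (b ⊗ₜ y)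
      = (a * b) • ((1 : SqZero K H) ⊗ₜ ℓ.br x y + homIncl K L H (m x y)) :=
  extBr_tmul _ a b x y

theorem sqZeroBr_one (x y : L) :
    sqZeroBr ℓ m (1 ⊗ₜ x) (1 ⊗ₜ y) = 1 ⊗ₜ ℓ.br x y + homIncl K L H (m x y) := by
  rw [sqZeroBr_tmul, mul_one, one_smul]

theorem sqZeroBr_left (x : L) (f : H →ₗ[K] L) :
    sqZeroBr ℓ m (1 ⊗ₜ x) (homIncl K L H f) = homIncl K L H (ℓ.br x ∘ₗ f) := by
  refine hom_induction
    (P := fun f => sqZeroBr ℓ m (1 ⊗ₜ x) (homIncl K L H f) = homIncl K L H (ℓ.br x ∘ₗ f)) f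
    (by rw [map_zero, map_zero, LinearMap.comp_zero, map_zero]) (fun f g hf hg => ?_)
    (fun g y => ?_)
  · rw [LinearMap.comp_add, map_add, map_add, hf, hg, map_add]
  · have e2 : ℓ.br x ∘ₗ dualTensorHom K H L (g ⊗ₜ y)
        = dualTensorHom K H L (g ⊗ₜ ℓ.br x y) := by ext; simp
    rw [homIncl_dualTensorHom, e2, homIncl_dualTensorHom, sqZeroBr_tmul, one_mul, smul_add,
      inr_smul_homIncl, add_zero, TensorProduct.smul_tmul', smul_eq_mul, mul_one]

theorem sqZeroBr_right (x : L) (f : H →ₗ[K] L) :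
    sqZeroBr ℓ m (homIncl K L H f) (1 ⊗ₜ x) = homIncl K L H (ℓ.br.flip x ∘ₗ f) := by
  refine hom_induction
    (P := fun f => sqZeroBr ℓ m (homIncl K L H f) (1 ⊗ₜ x) = homIncl K L H (ℓ.br.flip x ∘ₗ f)) f
    (by rw [map_zero, map_zero, LinearMap.zero_apply, LinearMap.comp_zero, map_zero])
    (fun f g hf hg => ?_) (fun g y => ?_)
  · rw [LinearMap.comp_add, map_add, map_add, LinearMap.add_apply, hf, hg, map_add]
  · have e2 : ℓ.br.flip x ∘ₗ dualTensorHom K H L (g ⊗ₜ y)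
        = dualTensorHom K H L (g ⊗ₜ ℓ.br y x) := by ext; simp
    rw [homIncl_dualTensorHom, e2, homIncl_dualTensorHom, sqZeroBr_tmul, mul_one, smul_add,
      inr_smul_homIncl, add_zero, TensorProduct.smul_tmul', smul_eq_mul, mul_one]

theorem six_term {G : Type*} [AddCommGroup G] {a b c p q r s t u : G} (h1 : a - b - c = 0)
    (h2 : p + q - (r + s) - (t + u) = 0) :
    a + q + p - (b + s + r) - (c + u + t) = 0 := by
  rw [← add_zero (0 : G)]
  nth_rw 1 [← h1]
  rw [← h2]
  abel

theorem jac_sqZeroBr (hm : ∀ x y z, (ℓ.br.flip z ∘ₗ m x y + m (ℓ.br x y) z)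
      - (ℓ.br.flip y ∘ₗ m x z + m (ℓ.br x z) y) - (ℓ.br x ∘ₗ m y z + m x (ℓ.br y z)) = 0)
    (x y z : L) : jac (sqZeroBr ℓ m) (1 ⊗ₜ x) (1 ⊗ₜ y) (1 ⊗ₜ z) = 0 := by
  have key := congrArg (homIncl K L H) (hm x y z)
  rw [map_sub, map_sub, map_add, map_add, map_add, map_zero] at key
  have hl : (1 : SqZero K H) ⊗ₜ[K] ℓ.br (ℓ.br x y) z - (1 : SqZero K H) ⊗ₜ[K] ℓ.br (ℓ.br x z) y
      - (1 : SqZero K H) ⊗ₜ[K] ℓ.br x (ℓ.br y z) = 0 := by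
    rw [← TensorProduct.tmul_sub, ← TensorProduct.tmul_sub, ℓ.leibniz, sub_self,
      TensorProduct.tmul_zero]
  rw [jac, sqZeroBr_one, sqZeroBr_one, sqZeroBr_one, map_add, map_add, map_add,
    LinearMap.add_apply, LinearMap.add_apply, sqZeroBr_one, sqZeroBr_one, sqZeroBr_one,
    sqZeroBr_left, sqZeroBr_right, sqZeroBr_right]
  exact six_term hl key

/-- The infinitesimal deformation of `L` with base `K ⊕ H'` given by a cocycle with values in
`Hom(H, L)`. -/
def sqZeroDeformation (hm : ∀ x y z, (ℓ.br.flip z ∘ₗ m x y + m (ℓ.br x y) z)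
      - (ℓ.br.flip y ∘ₗ m x z + m (ℓ.br x z) y) - (ℓ.br x ∘ₗ m y z + m x (ℓ.br y z)) = 0) :
    Deformation ℓ (augSqZero K H) where
  br := sqZeroBr ℓ m
  leibniz u v w := by
    have := jac_eq_zero (sqZeroBr ℓ m) (jac_sqZeroBr ℓ m hm) u v w
    rw [jac, sub_eq_zero] at this
    exact this.symm
  augMap_br := augMap_br_of_one _ _ (fun x y => by
    rw [sqZeroBr_one, map_add, augMap_homIncl, add_zero, augMap_tmul, map_one, one_smul])

end SquareZero

section Infinitesimal

variable {K : Type u} [Field K] {L : Type v} [AddCommGroup L] [Module K L] {ℓ : LeibnizStr K L}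

/-- The algebra `C₁ = K ⊕ ℍ'`, `ℍ = HL²(L;L)`, in which `ℍ'` has zero multiplication. -/
abbrev C1 (ℓ : LeibnizStr K L) := SqZero K (HL2 ℓ)

/-- The augmentation of `C₁`. -/
abbrev augC1 (ℓ : LeibnizStr K L) : C1 ℓ →ₐ[K] K := augSqZero K (HL2 ℓ)

/-- The map `(x,y) ↦ (h ↦ μ(h)(x,y))`. -/
def HL2Section.hom (μ : HL2Section ℓ) : L →ₗ[K] L →ₗ[K] (HL2 ℓ →ₗ[K] L) :=
  LinearMap.mk₂ K (fun x y =>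
      { toFun := fun h => (μ.toFun h : CL2 K L) x y
        map_add' := by simp
        map_smul' := by simp })
    (by intros; ext; simp) (by intros; ext; simp) (by intros; ext; simp) (by intros; ext; simp)

theorem HL2Section.hom_apply (μ : HL2Section ℓ) (x y : L) (h : HL2 ℓ) :
    μ.hom x y h = (μ.toFun h : CL2 K L) x y := rfl

theorem HL2Section.hom_leibniz (μ : HL2Section ℓ) (x y z : L) :
    (ℓ.br.flip z ∘ₗ μ.hom x y + μ.hom (ℓ.br x y) z)
      - (ℓ.br.flip y ∘ₗ μ.hom x z + μ.hom (ℓ.br x z) y)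
      - (ℓ.br x ∘ₗ μ.hom y z + μ.hom x (ℓ.br y z)) = 0 := by
  apply LinearMap.ext
  intro h
  have e : δ2 ℓ (μ.toFun h) x y z = 0 := by rw [LinearMap.mem_ker.1 (μ.toFun h).2]; rfl
  rw [δ2_apply] at e
  refine Eq.trans ?_ (neg_eq_zero.2 e)
  simp only [LinearMap.add_apply, LinearMap.sub_apply, LinearMap.comp_apply,
    HL2Section.hom_apply, LinearMap.flip_apply]
  abel

/-- The universal infinitesimal deformation `η₁` of `L` with base `C₁`, built from a choice `μ` of
representing cocycles: `[1⊗x,1⊗y] = 1⊗[x,y] + ∑ᵢ gᵢ⊗μ(hᵢ)(x,y)` for a basis `hᵢ` of `ℍ` with dual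
basis `gᵢ`. -/
def eta1 [FiniteDimensional K (HL2 ℓ)] (μ : HL2Section ℓ) : Deformation ℓ (augC1 ℓ) :=
  sqZeroDeformation ℓ μ.hom μ.hom_leibniz

end Infinitesimal

section Obstruction

variable {K : Type u} [Field K] {L : Type v} [AddCommGroup L] [Module K L] {A : Type w}
  [CommRing A] [Algebra K A] {ε : A →ₐ[K] K} {ℓ : LeibnizStr K L}

/-- An `Ā`-bilinear operation on `Ā ⊗ L` lifting the bracket of a deformation `η` with base `A`
(it need not satisfy the Leibniz identity), where `Ā` is the extension of `A` by
`H²_Harr(A;K)'`. -/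
structure Lift (s : HarrSection ε) (η : Deformation ℓ ε) where
  br : HarrExt s ⊗[K] L →ₗ[HarrExt s] HarrExt s ⊗[K] L →ₗ[HarrExt s] HarrExt s ⊗[K] L
  proj_br : ∀ u v, (HarrExt.proj s).toLinearMap.rTensor L (br u v)
    = η.br ((HarrExt.proj s).toLinearMap.rTensor L u) ((HarrExt.proj s).toLinearMap.rTensor L v)

theorem rTensor_algHom_smul {A B : Type*} [CommRing A] [Algebra K A] [CommRing B] [Algebra K B]
    (φ : A →ₐ[K] B) (c : A) (t : A ⊗[K] L) :
    φ.toLinearMap.rTensor L (c • t) = φ c • φ.toLinearMap.rTensor L t := by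
  induction t with
  | zero => simp
  | add s t hs ht => simp only [smul_add, map_add, hs, ht]
  | tmul d z => simp [TensorProduct.smul_tmul']

/-- Lifts exist: extend the structure constants of `η` along a linear section of `Ā → A`. -/
def Lift.std (s : HarrSection ε) (η : Deformation ℓ ε) : Lift s η where
  br := extBr ((η.br.restrictScalars₁₂ K K).compl₁₂ (TensorProduct.mk K A L 1)
      (TensorProduct.mk K A L 1) |>.compr₂
      (LinearMap.rTensor L (⟨⟨fun a => ⟨a, 0⟩, fun a b => by ext1 <;> simp⟩,
        fun c a => by ext1 <;> simp⟩ : A →ₗ[K] HarrExt s)))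
  proj_br u v := by
    induction u with
    | zero => simp
    | add u u' hu hu' => simp only [map_add, LinearMap.add_apply, hu, hu']
    | tmul a x =>
      induction v with
      | zero => simp
      | add u u' hu hu' => simp only [map_add, hu, hu']
      | tmul b y =>
        have e : ∀ (a : A) (x : L), a ⊗ₜ[K] x = a • ((1 : A) ⊗ₜ[K] x) := by
          intro a x; simp [TensorProduct.smul_tmul']
        rw [extBr_tmul, rTensor_algHom_smul, LinearMap.compr₂_apply, ← LinearMap.comp_apply,
          ← LinearMap.rTensor_comp, LinearMap.rTensor_tmul, LinearMap.rTensor_tmul]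
        have hid : (HarrExt.proj s).toLinearMap ∘ₗ
            (⟨⟨fun a => ⟨a, 0⟩, fun a b => by ext1 <;> simp⟩,
              fun c a => by ext1 <;> simp⟩ : A →ₗ[K] HarrExt s) = LinearMap.id := rfl
        rw [hid, LinearMap.rTensor_id, LinearMap.id_apply, AlgHom.toLinearMap_apply,
          AlgHom.toLinearMap_apply, e _ x, e _ y, LinearMap.map_smul (η.br _),
          LinearMap.map_smul η.br, LinearMap.smul_apply, smul_smul, map_mul, mul_comm]
        rfl

instance (s : HarrSection ε) (η : Deformation ℓ ε) : Nonempty (Lift s η) := ⟨Lift.std s η⟩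

/-- The functional `(a,m) ↦ m(h)` on `Ā`. -/
def fibEval (s : HarrSection ε) : H2Harr ε →ₗ[K] HarrExt s →ₗ[K] K :=
  LinearMap.mk₂ K (fun h x => x.fib h) (fun _ _ _ => map_add _ _ _) (fun _ _ _ => map_smul _ _ _)
    (fun _ _ _ => rfl) (fun _ _ _ => rfl)

variable (L) in
/-- The map `Ā ⊗ L → L` given by `(a,m) ⊗ x ↦ m(h) x`. On the subspace `H²_Harr(A;K)' ⊗ L`
it is the evaluation at the class `h`. -/
def evalMap (s : HarrSection ε) : H2Harr ε →ₗ[K] HarrExt s ⊗[K] L →ₗ[K] L :=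
  LinearMap.mk₂ K (fun h t => TensorProduct.lid K L ((fibEval s h).rTensor L t))
    (fun h h' t => by rw [map_add, LinearMap.rTensor_add, LinearMap.add_apply, map_add])
    (fun c h t => by rw [map_smul, LinearMap.rTensor_smul, LinearMap.smul_apply, map_smul])
    (fun h t t' => by rw [map_add, map_add])
    (fun c h t => by rw [map_smul, map_smul])

theorem evalMap_tmul (s : HarrSection ε) (h : H2Harr ε) (a : HarrExt s) (x : L) :
    evalMap L s h (a ⊗ₜ x) = a.fib h • x := by
  rw [evalMap, LinearMap.mk₂_apply, LinearMap.rTensor_tmul, TensorProduct.lid_tmul]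
  rfl

theorem HarrExt.incl_smul (s : HarrSection ε) (m : Module.Dual K (H2Harr ε))
    (u : HarrExt s ⊗[K] L) :
    HarrExt.incl s m • u = HarrExt.incl s m ⊗ₜ augMap L (HarrExt.aug s) u := by
  induction u with
  | zero => simp
  | add a b ha hb => rw [smul_add, ha, hb, map_add, TensorProduct.tmul_add]
  | tmul a x =>
    rw [TensorProduct.smul_tmul', smul_eq_mul, HarrExt.incl_mul, augMap_tmul, map_smul,
      TensorProduct.smul_tmul]

theorem exists_incl {s : HarrSection ε} {t : HarrExt s ⊗[K] L}
    (ht : (HarrExt.proj s).toLinearMap.rTensor L t = 0) :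
    ∃ t', (HarrExt.incl s).rTensor L t' = t := by
  have hex : Function.Exact (HarrExt.incl s) (HarrExt.proj s).toLinearMap := by
    intro x
    constructor
    · intro hx
      exact ⟨x.fib, by ext1; exacts [Eq.symm hx, rfl]⟩
    · rintro ⟨m, rfl⟩; rfl
  exact (_root_.rTensor_exact L hex (HarrExt.proj_surjective s) t).1 ht

theorem augMap_aug (s : HarrSection ε) (u : HarrExt s ⊗[K] L) :
    augMap L (HarrExt.aug s) u = augMap L ε ((HarrExt.proj s).toLinearMap.rTensor L u) := by
  induction u with
  | zero => simp
  | add a b ha hb => simp only [map_add, ha, hb]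
  | tmul a x => simp

theorem evalMap_smul {s : HarrSection ε} (h : H2Harr ε) (c : HarrExt s) {t : HarrExt s ⊗[K] L}
    (ht : (HarrExt.proj s).toLinearMap.rTensor L t = 0) :
    evalMap L s h (c • t) = HarrExt.aug s c • evalMap L s h t := by
  obtain ⟨t, rfl⟩ := exists_incl ht
  clear ht
  induction t with
  | zero => simp
  | add a b ha hb => simp only [map_add, smul_add, ha, hb]
  | tmul m x =>
    rw [LinearMap.rTensor_tmul, TensorProduct.smul_tmul', smul_eq_mul, mul_comm, HarrExt.incl_mul,
      evalMap_tmul, evalMap_tmul, HarrExt.fib_incl, HarrExt.fib_incl, LinearMap.smul_apply,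
      smul_assoc]

section

variable {s : HarrSection ε} {η : Deformation ℓ ε} (B : Lift s η)

theorem Lift.augMap_br (u v : HarrExt s ⊗[K] L) : augMap L (HarrExt.aug s) (B.br u v)
    = ℓ.br (augMap L (HarrExt.aug s) u) (augMap L (HarrExt.aug s) v) := by
  rw [augMap_aug, B.proj_br, η.augMap_br, augMap_aug, augMap_aug]

theorem Lift.proj_jac (u v w : HarrExt s ⊗[K] L) :
    (HarrExt.proj s).toLinearMap.rTensor L (jac B.br u v w) = 0 := by
  rw [jac, map_sub, map_sub, B.proj_br, B.proj_br, B.proj_br, B.proj_br, B.proj_br, B.proj_br,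
    η.leibniz, sub_self]

theorem Lift.evalMap_br_left (h : H2Harr ε) (x : L) {t : HarrExt s ⊗[K] L}
    (ht : (HarrExt.proj s).toLinearMap.rTensor L t = 0) :
    evalMap L s h (B.br (1 ⊗ₜ x) t) = ℓ.br x (evalMap L s h t) := by
  obtain ⟨t, rfl⟩ := exists_incl ht
  clear ht
  induction t with
  | zero => simp
  | add a b ha hb => simp only [map_add, ha, hb]
  | tmul m y =>
    have e : HarrExt.incl s m ⊗ₜ[K] y = HarrExt.incl s m • ((1 : HarrExt s) ⊗ₜ[K] y) := by
      rw [TensorProduct.smul_tmul', smul_eq_mul, mul_one]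
    rw [LinearMap.rTensor_tmul, evalMap_tmul, e, LinearMap.map_smul (B.br _), HarrExt.incl_smul,
      evalMap_tmul, B.augMap_br, augMap_tmul, augMap_tmul, map_one, one_smul, one_smul,
      LinearMap.map_smul (ℓ.br _)]

theorem Lift.evalMap_br_right (h : H2Harr ε) (x : L) {t : HarrExt s ⊗[K] L}
    (ht : (HarrExt.proj s).toLinearMap.rTensor L t = 0) :
    evalMap L s h (B.br t (1 ⊗ₜ x)) = ℓ.br (evalMap L s h t) x := by
  obtain ⟨t, rfl⟩ := exists_incl ht
  clear ht
  induction t with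
  | zero => simp
  | add a b ha hb => simp only [map_add, LinearMap.add_apply, ha, hb]
  | tmul m y =>
    have e : HarrExt.incl s m ⊗ₜ[K] y = HarrExt.incl s m • ((1 : HarrExt s) ⊗ₜ[K] y) := by
      rw [TensorProduct.smul_tmul', smul_eq_mul, mul_one]
    rw [LinearMap.rTensor_tmul, evalMap_tmul, e, LinearMap.map_smul B.br, LinearMap.smul_apply,
      HarrExt.incl_smul, evalMap_tmul, B.augMap_br, augMap_tmul, augMap_tmul, map_one, one_smul,
      one_smul, LinearMap.map_smul ℓ.br, LinearMap.smul_apply]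

theorem tmul_eq_smul_one (a : HarrExt s) (x : L) : a ⊗ₜ[K] x = a • ((1 : HarrExt s) ⊗ₜ[K] x) := by
  rw [TensorProduct.smul_tmul', smul_eq_mul, mul_one]

theorem Lift.evalMap_jac_1 (h : H2Harr ε) (u v w : HarrExt s ⊗[K] L) :
    evalMap L s h (jac B.br u v w)
      = evalMap L s h (jac B.br (1 ⊗ₜ augMap L (HarrExt.aug s) u) v w) := by
  have hadd : ∀ u u', jac B.br (u + u') v w = jac B.br u v w + jac B.br u' v w := by
    intro u u'; simp only [jac, map_add, LinearMap.add_apply]; abel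
  have hsmul : ∀ (c : HarrExt s) u, jac B.br (c • u) v w = c • jac B.br u v w := by
    intro c u; simp only [jac, LinearMap.map_smul B.br, LinearMap.smul_apply, smul_sub]
  have hsmulK : ∀ (c : K) (x : L), (1 : HarrExt s) ⊗ₜ[K] (c • x)
      = algebraMap K (HarrExt s) c • ((1 : HarrExt s) ⊗ₜ[K] x) := by
    intro c x; rw [TensorProduct.tmul_smul, algebraMap_smul]
  induction u with
  | zero => simp
  | add a b ha hb => rw [hadd, map_add, ha, hb, map_add, TensorProduct.tmul_add, hadd, map_add]
  | tmul a x =>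
    rw [tmul_eq_smul_one, hsmul, evalMap_smul h a (B.proj_jac _ _ _), augMap_smul, hsmulK, hsmul,
      evalMap_smul h _ (B.proj_jac _ _ _), AlgHom.commutes, augMap_tmul, map_one, one_smul]
    rfl

theorem Lift.evalMap_jac_2 (h : H2Harr ε) (u v w : HarrExt s ⊗[K] L) :
    evalMap L s h (jac B.br v u w)
      = evalMap L s h (jac B.br v (1 ⊗ₜ augMap L (HarrExt.aug s) u) w) := by
  have hadd : ∀ u u', jac B.br v (u + u') w = jac B.br v u w + jac B.br v u' w := by
    intro u u'; simp only [jac, map_add, LinearMap.add_apply]; abel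
  have hsmul : ∀ (c : HarrExt s) u, jac B.br v (c • u) w = c • jac B.br v u w := by
    intro c u
    simp only [jac, LinearMap.map_smul B.br, LinearMap.map_smul (B.br _), LinearMap.smul_apply,
      smul_sub]
  have hsmulK : ∀ (c : K) (x : L), (1 : HarrExt s) ⊗ₜ[K] (c • x)
      = algebraMap K (HarrExt s) c • ((1 : HarrExt s) ⊗ₜ[K] x) := by
    intro c x; rw [TensorProduct.tmul_smul, algebraMap_smul]
  induction u with
  | zero => simp
  | add a b ha hb => rw [hadd, map_add, ha, hb, map_add, TensorProduct.tmul_add, hadd, map_add]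
  | tmul a x =>
    rw [tmul_eq_smul_one, hsmul, evalMap_smul h a (B.proj_jac _ _ _), augMap_smul, hsmulK, hsmul,
      evalMap_smul h _ (B.proj_jac _ _ _), AlgHom.commutes, augMap_tmul, map_one, one_smul]
    rfl

theorem Lift.evalMap_jac_3 (h : H2Harr ε) (u v w : HarrExt s ⊗[K] L) :
    evalMap L s h (jac B.br v w u)
      = evalMap L s h (jac B.br v w (1 ⊗ₜ augMap L (HarrExt.aug s) u)) := by
  have hadd : ∀ u u', jac B.br v w (u + u') = jac B.br v w u + jac B.br v w u' := by
    intro u u'; simp only [jac, map_add, LinearMap.add_apply]; abel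
  have hsmul : ∀ (c : HarrExt s) u, jac B.br v w (c • u) = c • jac B.br v w u := by
    intro c u
    simp only [jac, LinearMap.map_smul B.br, LinearMap.map_smul (B.br _), LinearMap.smul_apply,
      smul_sub]
  have hsmulK : ∀ (c : K) (x : L), (1 : HarrExt s) ⊗ₜ[K] (c • x)
      = algebraMap K (HarrExt s) c • ((1 : HarrExt s) ⊗ₜ[K] x) := by
    intro c x; rw [TensorProduct.tmul_smul, algebraMap_smul]
  induction u with
  | zero => simp
  | add a b ha hb => rw [hadd, map_add, ha, hb, map_add, TensorProduct.tmul_add, hadd, map_add]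
  | tmul a x =>
    rw [tmul_eq_smul_one, hsmul, evalMap_smul h a (B.proj_jac _ _ _), augMap_smul, hsmulK, hsmul,
      evalMap_smul h _ (B.proj_jac _ _ _), AlgHom.commutes, augMap_tmul, map_one, one_smul]
    rfl

theorem Lift.augMap_br_one (x y : L) :
    augMap L (HarrExt.aug s) (B.br (1 ⊗ₜ x) (1 ⊗ₜ y)) = ℓ.br x y := by
  rw [B.augMap_br, augMap_tmul, augMap_tmul, map_one, one_smul, one_smul]

end

/-- The identity that makes the defect of the Leibniz identity a cocycle; it holds for every
bilinear operation. -/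
theorem jac_identity {R V : Type*} [CommRing R] [AddCommGroup V] [Module R V]
    (br : V →ₗ[R] V →ₗ[R] V) (x y z t : V) :
    br x (jac br y z t) + br (jac br x z t) y - br (jac br x y t) z + br (jac br x y z) t
      - jac br (br x y) z t + jac br (br x z) y t + jac br x (br y z) t
      - jac br (br x t) y z - jac br x (br y t) z - jac br x y (br z t) = 0 := by
  simp only [jac, map_sub, LinearMap.sub_apply]
  abel

/-- The defect `[[x,y],z] - [[x,z],y] - [x,[y,z]]` of the Leibniz identity for a lift of `η` to
`Ā`, which lies in `H²_Harr(A;K)' ⊗ L`, evaluated at a class `h`. -/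
def Lift.defect {s : HarrSection ε} {η : Deformation ℓ ε} (B : Lift s η) (h : H2Harr ε) :
    CL3 K L :=
  mk3 (fun x y z => evalMap L s h (jac B.br (1 ⊗ₜ x) (1 ⊗ₜ y) (1 ⊗ₜ z)))
    (by intros; simp only [jac, TensorProduct.tmul_add, map_add, map_sub, LinearMap.add_apply]; abel)
    (by intros; simp only [jac, TensorProduct.tmul_smul, LinearMap.map_smul_of_tower, map_sub,
          LinearMap.smul_apply, smul_sub])
    (by intros; simp only [jac, TensorProduct.tmul_add, map_add, map_sub, LinearMap.add_apply]; abel)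
    (by intros; simp only [jac, TensorProduct.tmul_smul, LinearMap.map_smul_of_tower, map_sub,
          LinearMap.smul_apply, smul_sub])
    (by intros; simp only [jac, TensorProduct.tmul_add, map_add, map_sub, LinearMap.add_apply]; abel)
    (by intros; simp only [jac, TensorProduct.tmul_smul, LinearMap.map_smul_of_tower, map_sub,
          LinearMap.smul_apply, smul_sub])

theorem Lift.defect_apply {s : HarrSection ε} {η : Deformation ℓ ε} (B : Lift s η) (h : H2Harr ε)
    (x y z : L) :
    B.defect h x y z = evalMap L s h (jac B.br (1 ⊗ₜ x) (1 ⊗ₜ y) (1 ⊗ₜ z)) := rfl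

theorem Lift.defect_mem {s : HarrSection ε} {η : Deformation ℓ ε} (B : Lift s η) (h : H2Harr ε) :
    B.defect h ∈ LinearMap.ker (δ3 ℓ) := by
  rw [LinearMap.mem_ker]
  ext x y z t
  have key := congrArg (evalMap L s h)
    (jac_identity B.br (1 ⊗ₜ x) (1 ⊗ₜ y) (1 ⊗ₜ z) (1 ⊗ₜ t))
  simp only [map_add, map_sub, map_zero] at key
  rw [B.evalMap_br_left h x (B.proj_jac _ _ _), B.evalMap_br_right h y (B.proj_jac _ _ _),
    B.evalMap_br_right h z (B.proj_jac _ _ _), B.evalMap_br_right h t (B.proj_jac _ _ _),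
    B.evalMap_jac_1 h (B.br (1 ⊗ₜ x) (1 ⊗ₜ y)), B.evalMap_jac_1 h (B.br (1 ⊗ₜ x) (1 ⊗ₜ z)),
    B.evalMap_jac_1 h (B.br (1 ⊗ₜ x) (1 ⊗ₜ t)), B.evalMap_jac_2 h (B.br (1 ⊗ₜ y) (1 ⊗ₜ z)),
    B.evalMap_jac_2 h (B.br (1 ⊗ₜ y) (1 ⊗ₜ t)), B.evalMap_jac_3 h (B.br (1 ⊗ₜ z) (1 ⊗ₜ t))] at key
  simp only [B.augMap_br_one] at key
  exact key

/-- The obstruction `ω : H²_Harr(A;K) → HL³(L;L)` to extending `η` to a deformation with base `Ā`,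
computed from a lift `B` of `η` to `Ā`: the class of the defect of the Leibniz identity. -/
def Lift.obstruction {s : HarrSection ε} {η : Deformation ℓ ε} (B : Lift s η) :
    H2Harr ε →ₗ[K] HL3 ℓ where
  toFun h := HL3.mk ℓ ⟨B.defect h, B.defect_mem h⟩
  map_add' h h' := by
    rw [← map_add]
    congr 1
    ext x y z
    simp [Lift.defect_apply]
  map_smul' c h := by
    rw [RingHom.id_apply, ← map_smul]
    congr 1
    ext x y z
    simp [Lift.defect_apply]

end Obstruction

section Massey

variable {K : Type u} [Field K]

/-- A (non-graded, i.e. concentrated in degree 0) cocommutative coassociative coalgebra `F` with a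
filtration `F₀ ⊂ F₁ ⊂ F` such that `F₀ ⊂ ker Δ` and `im Δ ⊂ F₁ ⊗ F₁`. -/
structure FiltCoalg (K : Type u) [Field K] (F : Type w) [AddCommGroup F] [Module K F] where
  comul : F →ₗ[K] F ⊗[K] F
  cocomm : (TensorProduct.comm K F F).toLinearMap ∘ₗ comul = comul
  coassoc : (TensorProduct.assoc K F F F).toLinearMap ∘ₗ comul.rTensor F ∘ₗ comul
    = comul.lTensor F ∘ₗ comul
  F₀ : Submodule K F
  F₁ : Submodule K F
  F₀_le_F₁ : F₀ ≤ F₁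
  F₀_le_ker : F₀ ≤ LinearMap.ker comul
  range_le : LinearMap.range comul ≤ LinearMap.range (TensorProduct.map F₁.subtype F₁.subtype)

theorem map_subtype_injective {F : Type w} [AddCommGroup F] [Module K F] (F₁ : Submodule K F) :
    Function.Injective (TensorProduct.map F₁.subtype F₁.subtype) := by
  rw [← LinearMap.lTensor_comp_rTensor]
  exact (Module.Flat.lTensor_preserves_injective_linearMap _ F₁.injective_subtype).comp
    (Module.Flat.rTensor_preserves_injective_linearMap _ F₁.injective_subtype)

/-- The comultiplication regarded as a map `F → F₁ ⊗ F₁`. -/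
def FiltCoalg.comul₁ {F : Type w} [AddCommGroup F] [Module K F] (Q : FiltCoalg K F) :
    F →ₗ[K] Q.F₁ ⊗[K] Q.F₁ :=
  (LinearEquiv.ofInjective _ (map_subtype_injective Q.F₁)).symm.toLinearMap ∘ₗ
    LinearMap.codRestrict _ Q.comul (fun φ => Q.range_le ⟨φ, rfl⟩)

theorem FiltCoalg.map_comul₁ {F : Type w} [AddCommGroup F] [Module K F] (Q : FiltCoalg K F)
    (φ : F) : TensorProduct.map Q.F₁.subtype Q.F₁.subtype (Q.comul₁ φ) = Q.comul φ := by
  have := LinearEquiv.apply_symm_apply (LinearEquiv.ofInjective _ (map_subtype_injective Q.F₁))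
    (LinearMap.codRestrict _ Q.comul (fun φ => Q.range_le ⟨φ, rfl⟩) φ)
  exact congrArg Subtype.val this

/-- The Massey `F`-bracket of `a : F₀ → HL²(L;L)` in the differential graded Lie algebra
`(CL*(L;L), ν, d)`, as the set of the linear maps `b : F/F₁ → HL³(L;L)` contained in it: there is
`α : F₁ → CL²(L;L)` with `dα = c • ν∘(α⊗α)∘Δ` such that `α` maps `F₀` to cocycles and induces `a`,
and `ν∘(α⊗α)∘Δ` maps `F` to cocycles and induces `b`.
The constant `c` is the normalisation of the defining equation: `c = 1` gives
`dα = ν∘(α⊗α)∘Δ`, and `c = 1/2` the Maurer-Cartan equation of deformations. -/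
def masseyBracket {L : Type v} [AddCommGroup L] [Module K L] (ℓ : LeibnizStr K L) (c : K)
    {F : Type w} [AddCommGroup F] [Module K F] (Q : FiltCoalg K F) (a : Q.F₀ →ₗ[K] HL2 ℓ) :
    Set (F ⧸ Q.F₁ →ₗ[K] HL3 ℓ) :=
  {b | ∃ α : Q.F₁ →ₗ[K] CL2 K L,
    (∀ φ : Q.F₁, d2 ℓ (α φ)
      = c • TensorProduct.lift (nu K L) (TensorProduct.map α α (Q.comul₁ φ))) ∧
    (∀ φ : Q.F₀, ∃ h : α (Submodule.inclusion Q.F₀_le_F₁ φ) ∈ LinearMap.ker (δ2 ℓ),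
      HL2.mk ℓ ⟨_, h⟩ = a φ) ∧
    (∀ φ : F, ∃ h : TensorProduct.lift (nu K L) (TensorProduct.map α α (Q.comul₁ φ))
        ∈ LinearMap.ker (δ3 ℓ),
      HL3.mk ℓ ⟨_, h⟩ = b (Submodule.Quotient.mk φ))}

section Dual

variable {N N₁ N₀ : Type*} [AddCommGroup N] [Module K N] [AddCommGroup N₁] [Module K N₁]
  [AddCommGroup N₀] [Module K N₀]

/-- The pairing of `N' ⊗ (N' ⊗ N')` with `(x, y, z)`. -/
def eval3 (x y z : N) : Module.Dual K N ⊗[K] (Module.Dual K N ⊗[K] Module.Dual K N) →ₗ[K] K :=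
  TensorProduct.lift ((LinearMap.mul K K).compl₁₂ (Module.Dual.eval K N x)
    (Module.Dual.eval K (N ⊗[K] N) (y ⊗ₜ z) ∘ₗ TensorProduct.dualDistrib K N N))

theorem eval3_assoc (x y z : N) (w : Module.Dual K N ⊗[K] Module.Dual K N) (g : Module.Dual K N) :
    eval3 x y z (TensorProduct.assoc K _ _ _ (w ⊗ₜ g))
      = TensorProduct.dualDistrib K N N w (x ⊗ₜ y) * g z := by
  induction w with
  | zero => simp
  | add a b ha hb =>
    rw [TensorProduct.add_tmul, map_add, map_add, map_add, ha, hb, LinearMap.add_apply, add_mul]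
  | tmul e f => simp [eval3, mul_assoc]

theorem dualDistrib_comm (t : Module.Dual K N ⊗[K] Module.Dual K N) (x y : N) :
    TensorProduct.dualDistrib K N N (TensorProduct.comm K _ _ t) (x ⊗ₜ y)
      = TensorProduct.dualDistrib K N N t (y ⊗ₜ x) := by
  induction t with
  | zero => simp
  | add a b ha hb => simp only [map_add, LinearMap.add_apply, ha, hb]
  | tmul f g => simp [mul_comm]

theorem dualDistrib_map {M : Type*} [AddCommGroup M] [Module K M] (p : N →ₗ[K] M)
    (t : Module.Dual K M ⊗[K] Module.Dual K M) (x y : N) :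
    TensorProduct.dualDistrib K N N (TensorProduct.map p.dualMap p.dualMap t) (x ⊗ₜ y)
      = TensorProduct.dualDistrib K M M t (p x ⊗ₜ p y) := by
  induction t with
  | zero => simp
  | add a b ha hb => simp only [map_add, LinearMap.add_apply, ha, hb]
  | tmul f g => simp

variable [FiniteDimensional K N]

/-- The comultiplication on `N'` dual to a multiplication on the finite dimensional space `N`. -/
def dualComul (mul : N →ₗ[K] N →ₗ[K] N) :
    Module.Dual K N →ₗ[K] Module.Dual K N ⊗[K] Module.Dual K N :=
  (TensorProduct.dualDistribEquiv K N N).symm.toLinearMap ∘ₗ (TensorProduct.lift mul).dualMap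

theorem dualDistrib_dualComul (mul : N →ₗ[K] N →ₗ[K] N) (φ : Module.Dual K N) (x y : N) :
    TensorProduct.dualDistrib K N N (dualComul mul φ) (x ⊗ₜ y) = φ (mul x y) := by
  have : TensorProduct.dualDistribEquiv K N N (dualComul mul φ) = (TensorProduct.lift mul).dualMap φ :=
    LinearEquiv.apply_symm_apply _ _
  exact LinearMap.congr_fun this (x ⊗ₜ y)

theorem tensor_ext {s t : Module.Dual K N ⊗[K] Module.Dual K N}
    (h : ∀ x y, TensorProduct.dualDistrib K N N s (x ⊗ₜ y)
      = TensorProduct.dualDistrib K N N t (x ⊗ₜ y)) : s = t := by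
  apply (TensorProduct.dualDistribEquiv K N N).injective
  apply TensorProduct.ext'
  exact h

theorem tensor_ext₃ {s t : Module.Dual K N ⊗[K] (Module.Dual K N ⊗[K] Module.Dual K N)}
    (h : ∀ x y z, eval3 x y z s = eval3 x y z t) : s = t := by
  have inj : Function.Injective
      ((TensorProduct.dualDistribEquiv K N (N ⊗[K] N)).toLinearMap ∘ₗ
        (TensorProduct.dualDistribEquiv K N N).toLinearMap.lTensor (Module.Dual K N)) :=
    (TensorProduct.dualDistribEquiv K N (N ⊗[K] N)).injective.comp
      (LinearEquiv.lTensor _ (TensorProduct.dualDistribEquiv K N N)).injective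
  apply inj
  have key : ∀ (r : Module.Dual K N ⊗[K] (Module.Dual K N ⊗[K] Module.Dual K N)) (x y z : N),
      ((TensorProduct.dualDistribEquiv K N (N ⊗[K] N)).toLinearMap ∘ₗ
        (TensorProduct.dualDistribEquiv K N N).toLinearMap.lTensor (Module.Dual K N)) r
        (x ⊗ₜ (y ⊗ₜ z)) = eval3 x y z r := by
    intro r x y z
    induction r with
    | zero => simp
    | add a b ha hb => rw [map_add, map_add, LinearMap.add_apply, ha, hb]
    | tmul f w => rfl
  apply TensorProduct.ext'
  intro x w
  induction w with
  | zero => simp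
  | add a b ha hb => rw [TensorProduct.tmul_add, map_add, map_add, ha, hb]
  | tmul y z => rw [key, key, h]

theorem eval3_lTensor (mul : N →ₗ[K] N →ₗ[K] N) (x y z : N)
    (t : Module.Dual K N ⊗[K] Module.Dual K N) :
    eval3 x y z ((dualComul mul).lTensor _ t)
      = TensorProduct.dualDistrib K N N t (x ⊗ₜ mul y z) := by
  induction t with
  | zero => simp
  | add a b ha hb => simp only [map_add, LinearMap.add_apply, ha, hb]
  | tmul f g =>
    simp only [LinearMap.lTensor_tmul, eval3, TensorProduct.lift.tmul, LinearMap.compl₁₂_apply,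
      LinearMap.comp_apply, Module.Dual.eval_apply, dualDistrib_dualComul,
      TensorProduct.dualDistrib_apply, LinearMap.mul_apply']

theorem eval3_rTensor (mul : N →ₗ[K] N →ₗ[K] N) (x y z : N)
    (t : Module.Dual K N ⊗[K] Module.Dual K N) :
    eval3 x y z (TensorProduct.assoc K _ _ _ ((dualComul mul).rTensor _ t))
      = TensorProduct.dualDistrib K N N t (mul x y ⊗ₜ z) := by
  induction t with
  | zero => simp
  | add a b ha hb => simp only [map_add, LinearMap.add_apply, ha, hb]
  | tmul f g =>
    rw [LinearMap.rTensor_tmul, eval3_assoc, dualDistrib_dualComul,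
      TensorProduct.dualDistrib_apply]

/-- The filtered coalgebra `F = N'` dual to a commutative associative (non-unital) finite
dimensional algebra `N` with quotients `N → N₁ → N₀`, where `F₁ = N₁'` and `F₀ = N₀'`. -/
def dualFiltCoalg (mul : N →ₗ[K] N →ₗ[K] N) (hcomm : ∀ x y, mul x y = mul y x)
    (hassoc : ∀ x y z, mul (mul x y) z = mul x (mul y z))
    (p : N →ₗ[K] N₁) (hp : Function.Surjective p) (hmul : ∀ x y, p x = 0 → mul x y = 0)
    (q : N₁ →ₗ[K] N₀) (hq : ∀ x y, q (p (mul x y)) = 0) :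
    FiltCoalg K (Module.Dual K N) where
  comul := dualComul mul
  cocomm := by
    apply LinearMap.ext
    intro φ
    apply tensor_ext
    intro x y
    rw [LinearMap.comp_apply, LinearEquiv.coe_coe, dualDistrib_comm, dualDistrib_dualComul,
      dualDistrib_dualComul, hcomm]
  coassoc := by
    apply LinearMap.ext
    intro φ
    apply tensor_ext₃
    intro x y z
    simp only [LinearMap.comp_apply, LinearEquiv.coe_coe]
    rw [eval3_rTensor, eval3_lTensor, dualDistrib_dualComul, dualDistrib_dualComul, hassoc]
  F₀ := LinearMap.range (q ∘ₗ p).dualMap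
  F₁ := LinearMap.range p.dualMap
  F₀_le_F₁ := by
    rintro _ ⟨ψ, rfl⟩
    exact ⟨q.dualMap ψ, rfl⟩
  F₀_le_ker := by
    rintro _ ⟨ψ, rfl⟩
    rw [LinearMap.mem_ker]
    apply tensor_ext
    intro x y
    rw [dualDistrib_dualComul]
    simp [hq]
  range_le := by
    rintro _ ⟨φ, rfl⟩
    have : FiniteDimensional K N₁ := Module.Finite.of_surjective p hp
    obtain ⟨σ, hσ⟩ := p.exists_rightInverse_of_surjective (LinearMap.range_eq_top.2 hp)
    have hσ' : ∀ y, p (σ y) = y := fun y => LinearMap.congr_fun hσ y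
    let mul₁ : N₁ →ₗ[K] N₁ →ₗ[K] N := mul.compl₁₂ σ σ
    let t := (TensorProduct.dualDistribEquiv K N₁ N₁).symm ((TensorProduct.lift mul₁).dualMap φ)
    have ht : ∀ x y, TensorProduct.dualDistrib K N₁ N₁ t (x ⊗ₜ y) = φ (mul (σ x) (σ y)) := by
      intro x y
      have : TensorProduct.dualDistribEquiv K N₁ N₁ t = (TensorProduct.lift mul₁).dualMap φ :=
        LinearEquiv.apply_symm_apply _ _
      exact LinearMap.congr_fun this (x ⊗ₜ y)
    have e : dualComul mul φ = TensorProduct.map p.dualMap p.dualMap t := by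
      apply tensor_ext
      intro x y
      rw [dualDistrib_map, ht, dualDistrib_dualComul]
      have h1 : ∀ y, mul x y = mul (σ (p x)) y := by
        intro y
        rw [← sub_eq_zero, ← LinearMap.sub_apply, ← map_sub]
        exact hmul _ _ (by rw [map_sub, hσ', sub_self])
      have h2 : ∀ x, mul x y = mul x (σ (p y)) := by
        intro x
        rw [hcomm x, hcomm x, ← sub_eq_zero, ← LinearMap.sub_apply, ← map_sub]
        exact hmul _ _ (by rw [map_sub, hσ', sub_self])
      rw [h1, h2]
    rw [e]
    refine ⟨TensorProduct.map p.dualMap.rangeRestrict p.dualMap.rangeRestrict t, ?_⟩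
    rw [← LinearMap.comp_apply, ← TensorProduct.map_comp]
    rfl

end Dual

end Massey

section MaximalIdeals

variable {K : Type u} [Field K]

/-- The maximal ideal `𝔐 = ker ε` of an augmented algebra, as a `K`-vector space. -/
def augIdeal {A : Type*} [CommRing A] [Algebra K A] (ε : A →ₐ[K] K) : Submodule K A :=
  LinearMap.ker ε.toLinearMap

theorem mem_augIdeal {A : Type*} [CommRing A] [Algebra K A] {ε : A →ₐ[K] K} {a : A} :
    a ∈ augIdeal ε ↔ ε a = 0 := Iff.rfl

/-- The multiplication of the maximal ideal. -/
def augIdealMul {A : Type*} [CommRing A] [Algebra K A] (ε : A →ₐ[K] K) :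
    augIdeal ε →ₗ[K] augIdeal ε →ₗ[K] augIdeal ε :=
  LinearMap.mk₂ K (fun x y => ⟨x.1 * y.1, by
      rw [mem_augIdeal, map_mul, mem_augIdeal.1 x.2, zero_mul]⟩)
    (fun _ _ _ => Subtype.ext (add_mul _ _ _)) (fun _ _ _ => Subtype.ext (smul_mul_assoc _ _ _))
    (fun _ _ _ => Subtype.ext (mul_add _ _ _)) (fun _ _ _ => Subtype.ext (mul_smul_comm _ _ _))

@[simp] theorem coe_augIdealMul {A : Type*} [CommRing A] [Algebra K A] (ε : A →ₐ[K] K)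
    (x y : augIdeal ε) : (augIdealMul ε x y : A) = x * y := rfl

/-- The map of maximal ideals induced by a homomorphism of augmented algebras. -/
def augIdealMap {A B : Type*} [CommRing A] [Algebra K A] [CommRing B] [Algebra K B]
    {ε : A →ₐ[K] K} {ε' : B →ₐ[K] K} (φ : A →ₐ[K] B) (h : ε'.comp φ = ε) :
    augIdeal ε →ₗ[K] augIdeal ε' :=
  φ.toLinearMap.restrict (fun a ha => by
    rw [mem_augIdeal] at ha ⊢
    rw [← ha, ← h]; rfl)

@[simp] theorem coe_augIdealMap {A B : Type*} [CommRing A] [Algebra K A] [CommRing B]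
    [Algebra K B] {ε : A →ₐ[K] K} {ε' : B →ₐ[K] K} (φ : A →ₐ[K] B) (h : ε'.comp φ = ε)
    (x : augIdeal ε) : (augIdealMap φ h x : B) = φ x := rfl

theorem augIdealMap_surjective {A B : Type*} [CommRing A] [Algebra K A] [CommRing B]
    [Algebra K B] {ε : A →ₐ[K] K} {ε' : B →ₐ[K] K} (φ : A →ₐ[K] B) (h : ε'.comp φ = ε)
    (hφ : Function.Surjective φ) : Function.Surjective (augIdealMap φ h) := by
  rintro ⟨b, hb⟩
  obtain ⟨a, rfl⟩ := hφ b
  exact ⟨⟨a, by rw [mem_augIdeal, ← h]; exact hb⟩, rfl⟩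

end MaximalIdeals

section Step

variable {K : Type u} [Field K] {A : Type w} [CommRing A] [Algebra K A] {ε : A →ₐ[K] K}
  {W : Type*} [AddCommGroup W] [Module K W]

/-- The ideal `ī(ω'(W'))` of `Ā`, for a linear map `ω : H²_Harr(A;K) → W` with dual
`ω' : W' → H²_Harr(A;K)'`. -/
def stepIdeal (s : HarrSection ε) (ω : H2Harr ε →ₗ[K] W) : Ideal (HarrExt s) where
  carrier := {x | ∃ g : Module.Dual K W, HarrExt.incl s (ω.dualMap g) = x}
  zero_mem' := ⟨0, by rw [map_zero, map_zero]⟩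
  add_mem' := by
    rintro _ _ ⟨g, rfl⟩ ⟨g', rfl⟩
    exact ⟨g + g', by rw [map_add, map_add]⟩
  smul_mem' := by
    rintro c _ ⟨g, rfl⟩
    exact ⟨HarrExt.aug s c • g, by
      rw [smul_eq_mul, mul_comm, HarrExt.incl_mul, map_smul]⟩

/-- The quotient `Ā / ī(ω'(W'))`. -/
abbrev StepAlg (s : HarrSection ε) (ω : H2Harr ε →ₗ[K] W) := HarrExt s ⧸ stepIdeal s ω

/-- The projection `Ā / ī(ω'(W')) → A`. -/
def stepProj (s : HarrSection ε) (ω : H2Harr ε →ₗ[K] W) : StepAlg s ω →ₐ[K] A :=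
  Ideal.Quotient.liftₐ (stepIdeal s ω) (HarrExt.proj s) (by rintro _ ⟨g, rfl⟩; rfl)

theorem stepProj_surjective (s : HarrSection ε) (ω : H2Harr ε →ₗ[K] W) :
    Function.Surjective (stepProj s ω) := fun a =>
  ⟨Ideal.Quotient.mk _ ⟨a, 0⟩, rfl⟩

/-- The augmentation of `Ā / ī(ω'(W'))`. -/
def stepAug (s : HarrSection ε) (ω : H2Harr ε →ₗ[K] W) : StepAlg s ω →ₐ[K] K :=
  ε.comp (stepProj s ω)

instance (s : HarrSection ε) (ω : H2Harr ε →ₗ[K] W) [Module.Finite K A] :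
    Module.Finite K (StepAlg s ω) :=
  Module.Finite.of_surjective (Ideal.Quotient.mkₐ K (stepIdeal s ω)).toLinearMap
    (Ideal.Quotient.mkₐ_surjective K _)

instance (s : HarrSection ε) (ω : H2Harr ε →ₗ[K] W) [IsLocalRing A] :
    IsLocalRing (StepAlg s ω) := by
  have : Nontrivial (StepAlg s ω) := (stepProj s ω).toRingHom.domain_nontrivial
  exact IsLocalRing.of_surjective' (Ideal.Quotient.mk (stepIdeal s ω))
    Ideal.Quotient.mk_surjective

end Step

section Stages

variable {K : Type u} [Field K] {L : Type v} [AddCommGroup L] [Module K L]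

/-- A stage of the inductive construction: a finite dimensional local algebra `C` with
augmentation `ε` and a projection `q` onto `C₁`, and a deformation `η` of `L` with base `C`. -/
structure Stage (ℓ : LeibnizStr K L) where
  C : Type (max u v)
  [commRing : CommRing C]
  [algebra : Algebra K C]
  [isLocalRing : IsLocalRing C]
  [finite : Module.Finite K C]
  ε : C →ₐ[K] K
  q : C →ₐ[K] C1 ℓ
  q_surjective : Function.Surjective q
  aug_q : (augC1 ℓ).comp q = ε
  η : Deformation ℓ ε

attribute [instance] Stage.commRing Stage.algebra Stage.isLocalRing Stage.finite

variable {ℓ : LeibnizStr K L}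

/-- The first stage: `C₁` with the universal infinitesimal deformation `η₁`. -/
def Stage.first [FiniteDimensional K (HL2 ℓ)] (μ : HL2Section ℓ) : Stage ℓ where
  C := C1 ℓ
  ε := augC1 ℓ
  q := AlgHom.id K _
  q_surjective := Function.surjective_id
  aug_q := rfl
  η := eta1 μ

/-- The stage following `S`, with base `C_{k+1} = C̄_{k+1} / ī(ω'(HL³(L;L)'))`, where `ω` is the
obstruction, and with a deformation `η'` of base `C_{k+1}`. -/
def Stage.next (S : Stage ℓ) (s : HarrSection S.ε) (B : Lift s S.η)
    (η' : Deformation ℓ (stepAug s B.obstruction)) : Stage ℓ where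
  C := StepAlg s B.obstruction
  ε := stepAug s B.obstruction
  q := S.q.comp (stepProj s B.obstruction)
  q_surjective := S.q_surjective.comp (stepProj_surjective s B.obstruction)
  aug_q := by rw [← AlgHom.comp_assoc, S.aug_q]; rfl
  η := η'

/-- `IsStage μ k S`: the pair `S = (C_k, η_k)` is obtained at the `k`-th stage of the inductive
construction of a versal deformation starting from `η₁`, for some choices of sections of the
Harrison cocycles and of extensions `η_{j+1}` of `η_j` with `(p_{j+1})_* η_{j+1} = η_j`. -/
inductive IsStage [FiniteDimensional K (HL2 ℓ)] (μ : HL2Section ℓ) : ℕ → Stage ℓ → Prop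
  | one : IsStage μ 1 (Stage.first μ)
  | succ {k : ℕ} {S : Stage ℓ} (hS : IsStage μ k S) (s : HarrSection S.ε) (B : Lift s S.η)
      (η' : Deformation ℓ (stepAug s B.obstruction))
      (hη' : IsPushout (stepProj s B.obstruction) η' S.η) : IsStage μ (k + 1) (S.next s B η')

end Stages

section StageCoalgebra

variable {K : Type u} [Field K]

/-- The projection `𝔐̄ → 𝔐` of the maximal ideal of `Ā` onto that of `A`. -/
def projIdeal {A : Type w} [CommRing A] [Algebra K A] {ε : A →ₐ[K] K} (s : HarrSection ε) :
    augIdeal (HarrExt.aug s) →ₗ[K] augIdeal ε :=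
  augIdealMap (HarrExt.proj s) (HarrExt.aug_eq s).symm

theorem projIdeal_surjective {A : Type w} [CommRing A] [Algebra K A] {ε : A →ₐ[K] K}
    (s : HarrSection ε) : Function.Surjective (projIdeal s) :=
  augIdealMap_surjective _ _ (HarrExt.proj_surjective s)

/-- The inclusion of `H²_Harr(A;K)'` in the maximal ideal of `Ā`. -/
def inclIdeal {A : Type w} [CommRing A] [Algebra K A] {ε : A →ₐ[K] K} (s : HarrSection ε) :
    Module.Dual K (H2Harr ε) →ₗ[K] augIdeal (HarrExt.aug s) :=
  LinearMap.codRestrict _ (HarrExt.incl s) (fun _ => map_zero ε)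

theorem eq_inclIdeal {A : Type w} [CommRing A] [Algebra K A] {ε : A →ₐ[K] K} (s : HarrSection ε)
    (x : augIdeal (HarrExt.aug s)) (hx : projIdeal s x = 0) :
    x = inclIdeal s (x : HarrExt s).fib := by
  have hx : (x : HarrExt s).base = 0 := congrArg Subtype.val hx
  apply Subtype.ext
  ext1
  exacts [hx, rfl]

theorem inclIdeal_mul {A : Type w} [CommRing A] [Algebra K A] {ε : A →ₐ[K] K} (s : HarrSection ε)
    (m : Module.Dual K (H2Harr ε)) (y : augIdeal (HarrExt.aug s)) :
    augIdealMul (HarrExt.aug s) (inclIdeal s m) y = 0 := by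
  apply Subtype.ext
  refine (HarrExt.incl_mul s m y).trans ?_
  rw [mem_augIdeal.1 y.2, zero_smul, map_zero]
  rfl

theorem augSqZero_mul {H : Type w} [AddCommGroup H] [Module K H] (x y : SqZero K H)
    (hx : augSqZero K H x = 0) (hy : augSqZero K H y = 0) : x * y = 0 := by
  have hx : x.fst = 0 := hx
  have hy : y.fst = 0 := hy
  ext1
  · rw [TrivSqZeroExt.fst_mul, hx, zero_mul]; rfl
  · rw [TrivSqZeroExt.snd_mul, hx, hy]
    simp

/-- The inclusion of `H'` in the maximal ideal of `K ⊕ H'` (an isomorphism). -/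
def inrIdeal (K : Type u) [Field K] (H : Type w) [AddCommGroup H] [Module K H] :
    Module.Dual K H →ₗ[K] augIdeal (augSqZero K H) :=
  LinearMap.codRestrict _ (TrivSqZeroExt.inrHom K (Module.Dual K H)) (fun _ => rfl)

variable {L : Type v} [AddCommGroup L] [Module K L] {ℓ : LeibnizStr K L}
  (S : Stage ℓ) (s : HarrSection S.ε)

/-- The projection `𝔐_k → 𝔐_1`. -/
def Stage.qIdeal : augIdeal S.ε →ₗ[K] augIdeal (augC1 ℓ) := augIdealMap S.q S.aug_q

theorem Stage.qIdeal_surjective : Function.Surjective S.qIdeal :=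
  augIdealMap_surjective _ _ S.q_surjective

theorem Stage.qIdeal_mul (x y : augIdeal (HarrExt.aug s)) :
    S.qIdeal (projIdeal s (augIdealMul (HarrExt.aug s) x y)) = 0 := by
  apply Subtype.ext
  refine (map_mul S.q (x : HarrExt s).base (y : HarrExt s).base).trans ?_
  exact augSqZero_mul _ _ (S.qIdeal (projIdeal s x)).2 (S.qIdeal (projIdeal s y)).2

/-- The coalgebra `F = (𝔐̄_{k+1})'` dual to the maximal ideal of `C̄_{k+1}`, filtered by
`F₁ = 𝔐_k'` and `F₀ = 𝔐_1'`. -/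
def Stage.coalg : FiltCoalg K (Module.Dual K (augIdeal (HarrExt.aug s))) :=
  dualFiltCoalg (augIdealMul (HarrExt.aug s))
    (fun _ _ => Subtype.ext (mul_comm _ _)) (fun _ _ _ => Subtype.ext (mul_assoc _ _ _))
    (projIdeal s) (projIdeal_surjective s)
    (fun x y hx => by rw [eq_inclIdeal s x hx, inclIdeal_mul])
    S.qIdeal (S.qIdeal_mul s)

/-- The identification `F/F₁ = H²_Harr(C_k;K)'' = H²_Harr(C_k;K)` given by restriction of
functionals on `𝔐̄_{k+1}` to `H²_Harr(C_k;K)'`. -/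
def Stage.quotEquiv :
    (Module.Dual K (augIdeal (HarrExt.aug s)) ⧸ (S.coalg s).F₁) ≃ₗ[K] H2Harr S.ε :=
  LinearEquiv.ofBijective
    ((S.coalg s).F₁.liftQ
      ((Module.evalEquiv K (H2Harr S.ε)).symm.toLinearMap ∘ₗ (inclIdeal s).dualMap)
      (by
        rintro _ ⟨ψ, rfl⟩
        rw [LinearMap.mem_ker, LinearMap.comp_apply, LinearEquiv.coe_coe,
          LinearEquiv.map_eq_zero_iff]
        apply LinearMap.ext
        intro m
        exact map_zero ψ))
    (by
      constructor
      · rw [← LinearMap.ker_eq_bot, Submodule.ker_liftQ_eq_bot]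
        intro φ hφ
        rw [LinearMap.mem_ker, LinearMap.comp_apply, LinearEquiv.coe_coe,
          LinearEquiv.map_eq_zero_iff] at hφ
        change φ ∈ LinearMap.range (projIdeal s).dualMap
        rw [LinearMap.range_dualMap_eq_dualAnnihilator_ker, Submodule.mem_dualAnnihilator]
        intro x hx
        rw [eq_inclIdeal s x hx]
        exact LinearMap.congr_fun hφ _
      · rw [← LinearMap.range_eq_top, Submodule.range_liftQ, LinearMap.range_eq_top]
        refine (Module.evalEquiv K (H2Harr S.ε)).symm.surjective.comp
          (LinearMap.dualMap_surjective_of_injective ?_)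
        intro m m' h
        exact congrArg (fun x : augIdeal (HarrExt.aug s) => (x : HarrExt s).fib) h)

/-- The identification `𝔐_1' = F₀` of functionals on `𝔐_1` with functionals on `𝔐̄_{k+1}` that
factor through `𝔐̄_{k+1} → 𝔐_k → 𝔐_1`. -/
def Stage.F₀Equiv : Module.Dual K (augIdeal (augC1 ℓ)) ≃ₗ[K] (S.coalg s).F₀ :=
  LinearEquiv.ofInjective (S.qIdeal ∘ₗ projIdeal s).dualMap
    (LinearMap.dualMap_injective_of_surjective
      (S.qIdeal_surjective.comp (projIdeal_surjective s)))

/-- The identity map `id : F₀ = 𝔐_1' = ℍ'' = ℍ`. -/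
def Stage.idH [FiniteDimensional K (HL2 ℓ)] : (S.coalg s).F₀ →ₗ[K] HL2 ℓ :=
  (Module.evalEquiv K (HL2 ℓ)).symm.toLinearMap ∘ₗ (inrIdeal K (HL2 ℓ)).dualMap ∘ₗ
    (S.F₀Equiv s).symm.toLinearMap

end StageCoalgebra

end LeibnizDeformation

end

noncomputable section

namespace LeibnizDeformation

section Evaluation

variable {K : Type u} [Field K] {L : Type v} [AddCommGroup L] [Module K L] {A : Type w}
  [CommRing A] [Algebra K A] (ε : A →ₐ[K] K)

/-- The projection `a ↦ a - ε(a)` of an augmented algebra onto its augmentation ideal. -/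
def augSplit : A →ₗ[K] augIdeal ε :=
  LinearMap.codRestrict _ (LinearMap.id - Algebra.linearMap K A ∘ₗ ε.toLinearMap)
    (fun a => by simp [mem_augIdeal])

theorem coe_augSplit (a : A) : (augSplit ε a : A) = a - algebraMap K A (ε a) := rfl

theorem augSplit_one : augSplit ε 1 = 0 := by
  apply Subtype.ext
  simp [coe_augSplit]

theorem augSplit_coe (x : augIdeal ε) : augSplit ε x = x := by
  apply Subtype.ext
  simp [coe_augSplit, mem_augIdeal.1 x.2]

theorem augSplit_mul (a b : A) : augSplit ε (a * b)
    = ε a • augSplit ε b + ε b • augSplit ε a + augIdealMul ε (augSplit ε a) (augSplit ε b) := by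
  apply Subtype.ext
  simp only [Submodule.coe_add, Submodule.coe_smul, coe_augIdealMul, coe_augSplit, map_mul,
    Algebra.smul_def]
  ring

variable (K L A) in
/-- The evaluation `A ⊗ L → L`, `a ⊗ x ↦ ψ(a) x`, at a functional `ψ`. -/
def evalDual : Module.Dual K A →ₗ[K] A ⊗[K] L →ₗ[K] L :=
  LinearMap.mk₂ K (fun ψ t => TensorProduct.lid K L (ψ.rTensor L t))
    (fun h h' t => by rw [LinearMap.rTensor_add, LinearMap.add_apply, map_add])
    (fun c h t => by rw [LinearMap.rTensor_smul, LinearMap.smul_apply, map_smul])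
    (fun h t t' => by rw [map_add, map_add])
    (fun c h t => by rw [map_smul, map_smul])

theorem evalDual_tmul (ψ : Module.Dual K A) (a : A) (x : L) :
    evalDual K L A ψ (a ⊗ₜ x) = ψ a • x := by
  simp [evalDual]

theorem evalDual_rTensor {B : Type*} [CommRing B] [Algebra K B] (f : A →ₗ[K] B)
    (ψ : Module.Dual K B) (t : A ⊗[K] L) :
    evalDual K L B ψ (f.rTensor L t) = evalDual K L A (ψ ∘ₗ f) t := by
  simp [evalDual, LinearMap.rTensor_comp]

theorem eq_of_evalDual {t t' : A ⊗[K] L} (h : ∀ ψ, evalDual K L A ψ t = evalDual K L A ψ t') :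
    t = t' := by
  classical
  let b := Module.Free.chooseBasis K A
  apply (TensorProduct.equivFinsuppOfBasisLeft b).injective
  ext i
  have key : ∀ t : A ⊗[K] L, TensorProduct.equivFinsuppOfBasisLeft b t i
      = evalDual K L A (b.coord i) t := by
    intro t
    induction t with
    | zero => simp
    | add a b ha hb => simp only [map_add, Finsupp.add_apply, ha, hb]
    | tmul a x => rw [TensorProduct.equivFinsuppOfBasisLeft_apply_tmul_apply, evalDual_tmul]; rfl
  rw [key, key, h]

variable (L) in
/-- The evaluation `A ⊗ L → L` at a functional on the augmentation ideal, extended by `0` on the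
unit. -/
def evalAug : Module.Dual K (augIdeal ε) →ₗ[K] A ⊗[K] L →ₗ[K] L :=
  evalDual K L A ∘ₗ (augSplit ε).dualMap

theorem evalAug_tmul (φ : Module.Dual K (augIdeal ε)) (a : A) (x : L) :
    evalAug L ε φ (a ⊗ₜ x) = φ (augSplit ε a) • x :=
  evalDual_tmul _ a x

theorem evalAug_one_tmul (φ : Module.Dual K (augIdeal ε)) (x : L) :
    evalAug L ε φ (1 ⊗ₜ x) = 0 := by
  rw [evalAug_tmul, augSplit_one, map_zero, zero_smul]

theorem evalDual_eq (ψ : Module.Dual K A) (t : A ⊗[K] L) :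
    evalDual K L A ψ t
      = ψ 1 • augMap L ε t + evalAug L ε (ψ ∘ₗ (augIdeal ε).subtype) t := by
  induction t with
  | zero => simp
  | add a b ha hb => simp only [map_add, ha, hb, smul_add]; abel
  | tmul a x =>
    rw [evalDual_tmul, augMap_tmul, evalAug_tmul, smul_smul, ← add_smul]
    congr 1
    simp [coe_augSplit, Algebra.algebraMap_eq_smul_one, mul_comm]

theorem eq_of_evalAug {t t' : A ⊗[K] L} (h₀ : augMap L ε t = augMap L ε t')
    (h : ∀ φ, evalAug L ε φ t = evalAug L ε φ t') : t = t' :=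
  eq_of_evalDual fun ψ => by rw [evalDual_eq ε, evalDual_eq ε, h₀, h]

theorem augSplit_map {B : Type*} [CommRing B] [Algebra K B] {ε' : B →ₐ[K] K} (f : A →ₐ[K] B)
    (hf : ε'.comp f = ε) (a : A) : augSplit ε' (f a) = augIdealMap f hf (augSplit ε a) := by
  apply Subtype.ext
  subst hf
  simp [coe_augSplit]

theorem evalAug_rTensor {B : Type*} [CommRing B] [Algebra K B] {ε' : B →ₐ[K] K} (f : A →ₐ[K] B)
    (hf : ε'.comp f = ε) (φ : Module.Dual K (augIdeal ε')) (t : A ⊗[K] L) :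
    evalAug L ε' φ (f.toLinearMap.rTensor L t)
      = evalAug L ε ((augIdealMap f hf).dualMap φ) t := by
  refine (evalDual_rTensor _ _ t).trans ?_
  rw [evalAug, LinearMap.comp_apply]
  congr 2
  ext a
  simp [augSplit_map ε f hf]

theorem augMap_rTensor {B : Type*} [CommRing B] [Algebra K B] {ε' : B →ₐ[K] K} (f : A →ₐ[K] B)
    (hf : ε'.comp f = ε) (t : A ⊗[K] L) :
    augMap L ε' (f.toLinearMap.rTensor L t) = augMap L ε t := by
  subst hf
  simp [augMap, LinearMap.rTensor_comp]

theorem dualDistrib_eq_lift {N : Type*} [AddCommGroup N] [Module K N]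
    (T : Module.Dual K N ⊗[K] Module.Dual K N) (x y : N) (z : L) :
    TensorProduct.dualDistrib K N N T (x ⊗ₜ y) • z
      = TensorProduct.lift ((LinearMap.lsmul K L).compl₁₂ (Module.Dual.eval K N x)
          ((LinearMap.toSpanSingleton K L z) ∘ₗ Module.Dual.eval K N y)) T := by
  induction T with
  | zero => simp
  | add a b ha hb => simp only [map_add, LinearMap.add_apply, add_smul, ha, hb]
  | tmul f g => simp [mul_smul, smul_comm (g y)]

theorem lift_zero' {M N P : Type*} [AddCommGroup M] [Module K M] [AddCommGroup N] [Module K N]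
    [AddCommGroup P] [Module K P] : TensorProduct.lift (0 : M →ₗ[K] N →ₗ[K] P) = 0 := by
  ext; simp

theorem lift_add' {M N P : Type*} [AddCommGroup M] [Module K M] [AddCommGroup N] [Module K N]
    [AddCommGroup P] [Module K P] (f g : M →ₗ[K] N →ₗ[K] P) :
    TensorProduct.lift (f + g) = TensorProduct.lift f + TensorProduct.lift g := by
  ext; simp

/-- The bilinear map `(φ', φ'') ↦ φ'(a) φ''(t)`. -/
def evalPair (a : A) (t : A ⊗[K] L) :
    Module.Dual K (augIdeal ε) →ₗ[K] Module.Dual K (augIdeal ε) →ₗ[K] L :=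
  (LinearMap.lsmul K L).compl₁₂ (Module.Dual.eval K _ (augSplit ε a))
    ((evalAug L ε).flip t)

theorem evalPair_apply (a : A) (t : A ⊗[K] L) (φ ψ : Module.Dual K (augIdeal ε)) :
    evalPair ε a t φ ψ = φ (augSplit ε a) • evalAug L ε ψ t := rfl

variable [Module.Finite K A]

/-- The comultiplication on the dual of the augmentation ideal. -/
abbrev augComul : Module.Dual K (augIdeal ε) →ₗ[K]
    Module.Dual K (augIdeal ε) ⊗[K] Module.Dual K (augIdeal ε) :=
  dualComul (augIdealMul ε)

theorem evalAug_smul (φ : Module.Dual K (augIdeal ε)) (a : A) (t : A ⊗[K] L) :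
    evalAug L ε φ (a • t) = ε a • evalAug L ε φ t + φ (augSplit ε a) • augMap L ε t
      + TensorProduct.lift (evalPair ε a t) (augComul ε φ) := by
  induction t with
  | zero =>
    have : evalPair ε a (0 : A ⊗[K] L) = 0 := by ext; simp [evalPair_apply]
    simp [this, lift_zero']
  | add t t' h h' =>
    have : evalPair ε a (t + t') = evalPair ε a t + evalPair ε a t' := by
      ext; simp [evalPair_apply]
    rw [smul_add, map_add, h, h', this, map_add, map_add, smul_add, smul_add, lift_add',
      LinearMap.add_apply]
    abel
  | tmul b x =>
    have : TensorProduct.lift (evalPair ε a (b ⊗ₜ[K] x)) (augComul ε φ)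
        = φ (augIdealMul ε (augSplit ε a) (augSplit ε b)) • x := by
      rw [← dualDistrib_dualComul, dualDistrib_eq_lift]
      congr 2
    rw [TensorProduct.smul_tmul', smul_eq_mul, evalAug_tmul, evalAug_tmul, augMap_tmul, this,
      augSplit_mul, map_add, map_add, map_smul, map_smul, smul_smul, smul_smul, add_smul, add_smul,
      smul_eq_mul, smul_eq_mul, mul_comm (ε b)]

end Evaluation

section Jacobiator

variable {K : Type u} [Field K] {L : Type v} [AddCommGroup L] [Module K L] {A : Type w}
  [CommRing A] [Algebra K A] (ε : A →ₐ[K] K) {ℓ : LeibnizStr K L}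

variable (K L) in
/-- The composition product as a bilinear map. -/
def circBilin : CL2 K L →ₗ[K] CL2 K L →ₗ[K] CL3 K L :=
  LinearMap.mk₂ K circ
    (by intros; ext; simp [circ_apply]; abel)
    (by intros; ext; simp [circ_apply, smul_sub])
    (by intros; ext; simp [circ_apply]; abel)
    (by intros; ext; simp [circ_apply, smul_sub])

theorem nu_eq : nu K L = circBilin K L + (circBilin K L).flip := by
  ext α β x y z
  rfl

/-- The cochain `φ ↦ ((x,y) ↦ φ([1 ⊗ x, 1 ⊗ y]))` of a bilinear operation on `A ⊗ L`. -/
def brCochain (br : A ⊗[K] L →ₗ[A] A ⊗[K] L →ₗ[A] A ⊗[K] L) :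
    Module.Dual K (augIdeal ε) →ₗ[K] CL2 K L where
  toFun φ := LinearMap.mk₂ K (fun x y => evalAug L ε φ (br (1 ⊗ₜ x) (1 ⊗ₜ y)))
    (by intros; simp [TensorProduct.tmul_add])
    (by intros; simp only [TensorProduct.tmul_smul, LinearMap.map_smul_of_tower,
          LinearMap.smul_apply])
    (by intros; simp [TensorProduct.tmul_add])
    (by intros; simp only [TensorProduct.tmul_smul, LinearMap.map_smul_of_tower])
  map_add' φ φ' := by ext; simp
  map_smul' c φ := by ext; simp

theorem brCochain_apply (br : A ⊗[K] L →ₗ[A] A ⊗[K] L →ₗ[A] A ⊗[K] L)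
    (φ : Module.Dual K (augIdeal ε)) (x y : L) :
    brCochain ε br φ x y = evalAug L ε φ (br (1 ⊗ₜ x) (1 ⊗ₜ y)) := rfl

/-- The bilinear map `(φ', φ'') ↦ φ''([1 ⊗ φ'(t), 1 ⊗ z])`. -/
def brPairRight (br : A ⊗[K] L →ₗ[A] A ⊗[K] L →ₗ[A] A ⊗[K] L) (z : L) (t : A ⊗[K] L) :
    Module.Dual K (augIdeal ε) →ₗ[K] Module.Dual K (augIdeal ε) →ₗ[K] L :=
  LinearMap.mk₂ K (fun φ ψ => brCochain ε br ψ (evalAug L ε φ t) z)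
    (by intros; simp) (by intros; simp) (by intros; simp) (by intros; simp)

/-- The bilinear map `(φ', φ'') ↦ φ''([1 ⊗ x, 1 ⊗ φ'(t)])`. -/
def brPairLeft (br : A ⊗[K] L →ₗ[A] A ⊗[K] L →ₗ[A] A ⊗[K] L) (x : L) (t : A ⊗[K] L) :
    Module.Dual K (augIdeal ε) →ₗ[K] Module.Dual K (augIdeal ε) →ₗ[K] L :=
  LinearMap.mk₂ K (fun φ ψ => brCochain ε br ψ x (evalAug L ε φ t))
    (by intros; simp) (by intros; simp) (by intros; simp) (by intros; simp)

theorem brPairRight_apply (br : A ⊗[K] L →ₗ[A] A ⊗[K] L →ₗ[A] A ⊗[K] L) (z : L) (t : A ⊗[K] L)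
    (φ ψ : Module.Dual K (augIdeal ε)) :
    brPairRight ε br z t φ ψ = brCochain ε br ψ (evalAug L ε φ t) z := rfl

theorem brPairLeft_apply (br : A ⊗[K] L →ₗ[A] A ⊗[K] L →ₗ[A] A ⊗[K] L) (x : L) (t : A ⊗[K] L)
    (φ ψ : Module.Dual K (augIdeal ε)) :
    brPairLeft ε br x t φ ψ = brCochain ε br ψ x (evalAug L ε φ t) := rfl

theorem tmul_eq_smul (a : A) (x : L) : a ⊗ₜ[K] x = a • ((1 : A) ⊗ₜ[K] x) := by
  rw [TensorProduct.smul_tmul', smul_eq_mul, mul_one]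

variable [Module.Finite K A] {br : A ⊗[K] L →ₗ[A] A ⊗[K] L →ₗ[A] A ⊗[K] L}

theorem evalAug_br_right (hbr : ∀ x y : L, augMap L ε (br (1 ⊗ₜ x) (1 ⊗ₜ y)) = ℓ.br x y)
    (φ : Module.Dual K (augIdeal ε)) (z : L) (t : A ⊗[K] L) :
    evalAug L ε φ (br t (1 ⊗ₜ z)) = brCochain ε br φ (augMap L ε t) z
      + ℓ.br (evalAug L ε φ t) z + TensorProduct.lift (brPairRight ε br z t) (augComul ε φ) := by
  induction t with
  | zero =>
    have : brPairRight ε br z 0 = 0 := by ext; simp [brPairRight_apply]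
    simp [this, lift_zero']
  | add t t' h h' =>
    have : brPairRight ε br z (t + t') = brPairRight ε br z t + brPairRight ε br z t' := by
      ext; simp [brPairRight_apply]
    rw [map_add br, LinearMap.add_apply, map_add, h, h', this, lift_add', LinearMap.add_apply]
    simp only [map_add, LinearMap.add_apply]
    abel
  | tmul a x =>
    have : brPairRight ε br z (a ⊗ₜ x) = evalPair ε a (br (1 ⊗ₜ x) (1 ⊗ₜ z)) := by
      ext f g
      simp [brPairRight_apply, evalPair_apply, evalAug_tmul, brCochain_apply]
    rw [this, tmul_eq_smul a x, LinearMap.map_smul br, LinearMap.smul_apply, evalAug_smul, hbr,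
      ← tmul_eq_smul, augMap_tmul, evalAug_tmul, brCochain_apply, TensorProduct.tmul_smul,
      LinearMap.map_smul_of_tower, LinearMap.smul_apply, map_smul, map_smul, LinearMap.smul_apply]

theorem evalAug_br_left (hbr : ∀ x y : L, augMap L ε (br (1 ⊗ₜ x) (1 ⊗ₜ y)) = ℓ.br x y)
    (φ : Module.Dual K (augIdeal ε)) (x : L) (t : A ⊗[K] L) :
    evalAug L ε φ (br (1 ⊗ₜ x) t) = brCochain ε br φ x (augMap L ε t)
      + ℓ.br x (evalAug L ε φ t) + TensorProduct.lift (brPairLeft ε br x t) (augComul ε φ) := by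
  induction t with
  | zero =>
    have : brPairLeft ε br x 0 = 0 := by ext; simp [brPairLeft_apply]
    simp [this, lift_zero']
  | add t t' h h' =>
    have : brPairLeft ε br x (t + t') = brPairLeft ε br x t + brPairLeft ε br x t' := by
      ext; simp [brPairLeft_apply]
    rw [map_add (br _), map_add, h, h', this, lift_add', LinearMap.add_apply]
    simp only [map_add]
    abel
  | tmul a y =>
    have : brPairLeft ε br x (a ⊗ₜ y) = evalPair ε a (br (1 ⊗ₜ x) (1 ⊗ₜ y)) := by
      ext f g
      simp [brPairLeft_apply, evalPair_apply, evalAug_tmul, brCochain_apply]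
    rw [this, tmul_eq_smul a y, LinearMap.map_smul (br _), evalAug_smul, hbr,
      ← tmul_eq_smul, augMap_tmul, evalAug_tmul, brCochain_apply, TensorProduct.tmul_smul,
      LinearMap.map_smul_of_tower, map_smul, map_smul]

theorem dualComul_comm {N : Type*} [AddCommGroup N] [Module K N] [FiniteDimensional K N]
    {mul : N →ₗ[K] N →ₗ[K] N} (hcomm : ∀ x y, mul x y = mul y x) (φ : Module.Dual K N) :
    TensorProduct.comm K _ _ (dualComul mul φ) = dualComul mul φ := by
  apply tensor_ext
  intro x y
  rw [dualDistrib_comm, dualDistrib_dualComul, dualDistrib_dualComul, hcomm]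

theorem lift_nu_map (α : Module.Dual K (augIdeal ε) →ₗ[K] CL2 K L)
    (φ : Module.Dual K (augIdeal ε)) :
    TensorProduct.lift (nu K L) (TensorProduct.map α α (augComul ε φ))
      = (2 : K) • TensorProduct.lift (circBilin K L).flip
          (TensorProduct.map α α (augComul ε φ)) := by
  have key : TensorProduct.lift (circBilin K L) (TensorProduct.map α α (augComul ε φ))
      = TensorProduct.lift (circBilin K L).flip (TensorProduct.map α α (augComul ε φ)) := by
    conv_lhs => rw [← dualComul_comm (mul := augIdealMul ε)
      (fun _ _ => Subtype.ext (mul_comm _ _)) φ]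
    generalize augComul ε φ = T
    induction T with
    | zero => simp
    | add a b ha hb => simp only [map_add, ha, hb]
    | tmul f g => simp
  rw [nu_eq, lift_add', LinearMap.add_apply, key, two_smul]

/-- The defect of the Leibniz identity of a bilinear operation lifting the bracket of `L`, evaluated
at a functional on the augmentation ideal. -/
theorem two_smul_evalAug_jac
    (hbr : ∀ x y : L, augMap L ε (br (1 ⊗ₜ x) (1 ⊗ₜ y)) = ℓ.br x y)
    (φ : Module.Dual K (augIdeal ε)) (x y z : L) :
    (2 : K) • evalAug L ε φ (jac br (1 ⊗ₜ x) (1 ⊗ₜ y) (1 ⊗ₜ z))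
      = TensorProduct.lift (nu K L) (TensorProduct.map (brCochain ε br) (brCochain ε br)
          (augComul ε φ)) x y z - (2 : K) • δ2 ℓ (brCochain ε br φ) x y z := by
  have key : ∀ T, TensorProduct.lift (circBilin K L).flip
        (TensorProduct.map (brCochain ε br) (brCochain ε br) T) x y z
      = TensorProduct.lift (brPairRight ε br z (br (1 ⊗ₜ x) (1 ⊗ₜ y))) T
        - TensorProduct.lift (brPairRight ε br y (br (1 ⊗ₜ x) (1 ⊗ₜ z))) T
        - TensorProduct.lift (brPairLeft ε br x (br (1 ⊗ₜ y) (1 ⊗ₜ z))) T := by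
    intro T
    induction T with
    | zero => simp
    | add a b ha hb => simp only [map_add, LinearMap.add_apply, ha, hb]; abel
    | tmul f g => rfl
  rw [lift_nu_map, LinearMap.smul_apply, LinearMap.smul_apply, LinearMap.smul_apply, ← smul_sub,
    key, jac, map_sub, map_sub, evalAug_br_right ε hbr φ z (br _ _),
    evalAug_br_right ε hbr φ y (br _ _), evalAug_br_left ε hbr φ x (br _ _), hbr, hbr, hbr, δ2_apply]
  simp only [← brCochain_apply]
  congr 1
  abel

end Jacobiator

section Pushout

variable {K : Type u} [Field K] {L : Type v} [AddCommGroup L] [Module K L] {ℓ : LeibnizStr K L}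

theorem brCochain_map {A B : Type*} [CommRing A] [Algebra K A] [CommRing B] [Algebra K B]
    {ε : A →ₐ[K] K} {ε' : B →ₐ[K] K} (f : A →ₐ[K] B) (hf : ε'.comp f = ε)
    {br : A ⊗[K] L →ₗ[A] A ⊗[K] L →ₗ[A] A ⊗[K] L} {br' : B ⊗[K] L →ₗ[B] B ⊗[K] L →ₗ[B] B ⊗[K] L}
    (h : ∀ x y : L, br' (1 ⊗ₜ x) (1 ⊗ₜ y) = f.toLinearMap.rTensor L (br (1 ⊗ₜ x) (1 ⊗ₜ y)))
    (ψ : Module.Dual K (augIdeal ε')) :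
    brCochain ε' br' ψ = brCochain ε br ((augIdealMap f hf).dualMap ψ) := by
  ext x y
  rw [brCochain_apply, brCochain_apply, h, evalAug_rTensor ε f hf]

theorem Deformation.augMap_br_one {A : Type*} [CommRing A] [Algebra K A] {ε : A →ₐ[K] K}
    (η : Deformation ℓ ε) (x y : L) : augMap L ε (η.br (1 ⊗ₜ x) (1 ⊗ₜ y)) = ℓ.br x y := by
  rw [η.augMap_br, augMap_tmul, augMap_tmul, map_one, one_smul, one_smul]

theorem isPushout_of_isStage [FiniteDimensional K (HL2 ℓ)] {μ : HL2Section ℓ} {k : ℕ}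
    {S : Stage ℓ} (hS : IsStage μ k S) : IsPushout S.q S.η (eta1 μ) := by
  induction hS with
  | one =>
    intro x y
    exact (LinearMap.rTensor_id_apply _ _ _).symm
  | succ hS s B η' hη' ih =>
    intro x y
    rw [ih, hη', ← LinearMap.comp_apply, ← LinearMap.rTensor_comp]
    rfl

theorem evalAug_homIncl {H : Type*} [AddCommGroup H] [Module K H] [FiniteDimensional K H]
    (ψ : Module.Dual K (augIdeal (augSqZero K H))) (f : H →ₗ[K] L) :
    evalAug L (augSqZero K H) ψ (homIncl K L H f)
      = f ((Module.evalEquiv K H).symm ((inrIdeal K H).dualMap ψ)) := by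
  refine hom_induction (P := fun f => evalAug L (augSqZero K H) ψ (homIncl K L H f)
    = f ((Module.evalEquiv K H).symm ((inrIdeal K H).dualMap ψ))) f (by simp)
    (fun f g hf hg => by rw [map_add, map_add, hf, hg, LinearMap.add_apply]) (fun g x => ?_)
  have h1 : augSplit (augSqZero K H) (TrivSqZeroExt.inr g) = inrIdeal K H g :=
    augSplit_coe (augSqZero K H) (inrIdeal K H g)
  have h2 : g ((Module.evalEquiv K H).symm ((inrIdeal K H).dualMap ψ)) = ψ (inrIdeal K H g) := by
    rw [Module.apply_evalEquiv_symm_apply]; rfl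
  rw [homIncl_dualTensorHom, evalAug_tmul, h1, dualTensorHom_apply, h2]

theorem brCochain_eta1 [FiniteDimensional K (HL2 ℓ)] (μ : HL2Section ℓ)
    (ψ : Module.Dual K (augIdeal (augC1 ℓ))) :
    brCochain (augC1 ℓ) (eta1 μ).br ψ
      = μ.toFun ((Module.evalEquiv K (HL2 ℓ)).symm ((inrIdeal K (HL2 ℓ)).dualMap ψ)) := by
  ext x y
  rw [brCochain_apply]
  refine (congrArg _ (sqZeroBr_one ℓ μ.hom x y)).trans ?_
  rw [map_add, evalAug_one_tmul, zero_add, evalAug_homIncl, HL2Section.hom_apply]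

end Pushout

section MasseyLift

variable {K : Type u} [Field K] {L : Type v} [AddCommGroup L] [Module K L] {ℓ : LeibnizStr K L}
  (S : Stage ℓ) (s : HarrSection S.ε)

theorem Stage.coalg_comul : (S.coalg s).comul = augComul (HarrExt.aug s) := rfl

/-- The identification `𝔐_k' = F₁`. -/
def Stage.F₁Equiv : Module.Dual K (augIdeal S.ε) ≃ₗ[K] (S.coalg s).F₁ :=
  LinearEquiv.ofInjective (projIdeal s).dualMap
    (LinearMap.dualMap_injective_of_surjective (projIdeal_surjective s))

theorem Stage.inclusion_F₀Equiv (ψ : Module.Dual K (augIdeal (augC1 ℓ))) :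
    Submodule.inclusion (S.coalg s).F₀_le_F₁ (S.F₀Equiv s ψ)
      = S.F₁Equiv s (S.qIdeal.dualMap ψ) := rfl

theorem Stage.idH_F₀Equiv [FiniteDimensional K (HL2 ℓ)]
    (ψ : Module.Dual K (augIdeal (augC1 ℓ))) :
    S.idH s (S.F₀Equiv s ψ)
      = (Module.evalEquiv K (HL2 ℓ)).symm ((inrIdeal K (HL2 ℓ)).dualMap ψ) := by
  simp [Stage.idH]

theorem Stage.apply_quotEquiv (φ : Module.Dual K (augIdeal (HarrExt.aug s)))
    (m : Module.Dual K (H2Harr S.ε)) :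
    m (S.quotEquiv s (Submodule.Quotient.mk φ)) = φ (inclIdeal s m) := by
  have : S.quotEquiv s (Submodule.Quotient.mk φ)
      = (Module.evalEquiv K (H2Harr S.ε)).symm ((inclIdeal s).dualMap φ) := rfl
  rw [this, Module.apply_evalEquiv_symm_apply]
  rfl

theorem Stage.evalMap_quotEquiv (φ : Module.Dual K (augIdeal (HarrExt.aug s)))
    {t : HarrExt s ⊗[K] L} (ht : (HarrExt.proj s).toLinearMap.rTensor L t = 0) :
    evalMap L s (S.quotEquiv s (Submodule.Quotient.mk φ)) t = evalAug L (HarrExt.aug s) φ t := by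
  obtain ⟨t, rfl⟩ := exists_incl ht
  clear ht
  induction t with
  | zero => simp
  | add a b ha hb => simp only [map_add, ha, hb]
  | tmul m x =>
    have h : augSplit (HarrExt.aug s) (HarrExt.incl s m) = inclIdeal s m :=
      augSplit_coe (HarrExt.aug s) (inclIdeal s m)
    rw [LinearMap.rTensor_tmul, evalMap_tmul, evalAug_tmul, h, HarrExt.fib_incl,
      S.apply_quotEquiv]

variable {S s}

theorem Lift.brCochain_proj {η : Deformation ℓ S.ε} (B : Lift s η)
    (ψ : Module.Dual K (augIdeal S.ε)) :
    brCochain (HarrExt.aug s) B.br ((projIdeal s).dualMap ψ) = brCochain S.ε η.br ψ := by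
  refine (brCochain_map (HarrExt.proj s) (HarrExt.aug_eq s).symm (fun x y => ?_) ψ).symm
  rw [B.proj_br]
  simp

theorem map_comul₁_eq {α : (S.coalg s).F₁ →ₗ[K] CL2 K L} {η : Deformation ℓ S.ε}
    (hα : ∀ ψ, α (S.F₁Equiv s ψ) = brCochain S.ε η.br ψ) (B : Lift s η)
    (φ : Module.Dual K (augIdeal (HarrExt.aug s))) :
    TensorProduct.map α α ((S.coalg s).comul₁ φ)
      = TensorProduct.map (brCochain (HarrExt.aug s) B.br) (brCochain (HarrExt.aug s) B.br)
          (augComul (HarrExt.aug s) φ) := by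
  have e : α = brCochain (HarrExt.aug s) B.br ∘ₗ (S.coalg s).F₁.subtype := by
    ext1 φ
    obtain ⟨ψ, rfl⟩ := (S.F₁Equiv s).surjective φ
    rw [hα, ← B.brCochain_proj]
    rfl
  rw [← Stage.coalg_comul, ← FiltCoalg.map_comul₁, e, TensorProduct.map_comp,
    LinearMap.comp_apply]

/-- The expression `ν ∘ (α ⊗ α) ∘ Δ` for the cochain `α` of a deformation, in terms of the defect of
a lift. -/
theorem lift_nu_comul₁ {α : (S.coalg s).F₁ →ₗ[K] CL2 K L} {η : Deformation ℓ S.ε}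
    (hα : ∀ ψ, α (S.F₁Equiv s ψ) = brCochain S.ε η.br ψ) (B : Lift s η)
    (φ : Module.Dual K (augIdeal (HarrExt.aug s))) :
    TensorProduct.lift (nu K L) (TensorProduct.map α α ((S.coalg s).comul₁ φ))
      = (2 : K) • B.defect (S.quotEquiv s (Submodule.Quotient.mk φ))
        + (2 : K) • δ2 ℓ (brCochain (HarrExt.aug s) B.br φ) := by
  ext x y z
  rw [map_comul₁_eq hα B, LinearMap.add_apply, LinearMap.add_apply, LinearMap.add_apply,
    ← sub_eq_iff_eq_add]
  refine (two_smul_evalAug_jac (HarrExt.aug s) B.augMap_br_one φ x y z).symm.trans ?_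
  rw [LinearMap.smul_apply, LinearMap.smul_apply, LinearMap.smul_apply, B.defect_apply,
    S.evalMap_quotEquiv s φ (B.proj_jac _ _ _)]

theorem δ2_mem_ker (α : CL2 K L) : δ2 ℓ α ∈ LinearMap.ker (δ3 ℓ) :=
  LinearMap.congr_fun (δ3_comp_δ2 ℓ) α

theorem HL3.mk_δ2 (α : CL2 K L) : HL3.mk ℓ ⟨δ2 ℓ α, δ2_mem_ker α⟩ = 0 :=
  (Submodule.Quotient.mk_eq_zero _).2 ⟨α, rfl⟩

theorem mk_lift_nu_comul₁ {α : (S.coalg s).F₁ →ₗ[K] CL2 K L} {η : Deformation ℓ S.ε}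
    (hα : ∀ ψ, α (S.F₁Equiv s ψ) = brCochain S.ε η.br ψ) (B : Lift s η)
    (φ : Module.Dual K (augIdeal (HarrExt.aug s))) :
    ∃ h : TensorProduct.lift (nu K L) (TensorProduct.map α α ((S.coalg s).comul₁ φ))
        ∈ LinearMap.ker (δ3 ℓ),
      HL3.mk ℓ ⟨_, h⟩
        = (2 : K) • B.obstruction (S.quotEquiv s (Submodule.Quotient.mk φ)) := by
  have e := lift_nu_comul₁ hα B φ
  have h : TensorProduct.lift (nu K L) (TensorProduct.map α α ((S.coalg s).comul₁ φ))
      ∈ LinearMap.ker (δ3 ℓ) := by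
    rw [e]
    exact add_mem (Submodule.smul_mem _ _ (B.defect_mem _))
      (Submodule.smul_mem _ _ (δ2_mem_ker _))
  refine ⟨h, ?_⟩
  have e' : (⟨_, h⟩ : LinearMap.ker (δ3 ℓ))
      = (2 : K) • ⟨_, B.defect_mem (S.quotEquiv s (Submodule.Quotient.mk φ))⟩
        + (2 : K) • ⟨_, δ2_mem_ker (brCochain (HarrExt.aug s) B.br φ)⟩ := Subtype.ext e
  rw [e', map_add, map_smul, map_smul, HL3.mk_δ2, smul_zero, add_zero]
  rfl

theorem obstruction_eq [CharZero K] {η : Deformation ℓ S.ε} (B B' : Lift s η) :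
    B.obstruction = B'.obstruction := by
  ext1 h
  obtain ⟨φ, rfl⟩ := (S.quotEquiv s).surjective h
  obtain ⟨φ, rfl⟩ := Submodule.Quotient.mk_surjective _ φ
  have hα : ∀ ψ, (brCochain S.ε η.br ∘ₗ (S.F₁Equiv s).symm.toLinearMap) (S.F₁Equiv s ψ)
      = brCochain S.ε η.br ψ := by simp
  obtain ⟨_, e⟩ := mk_lift_nu_comul₁ hα B φ
  obtain ⟨_, e'⟩ := mk_lift_nu_comul₁ hα B' φ
  exact smul_right_injective _ (two_ne_zero : (2 : K) ≠ 0) (e.symm.trans e')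

theorem obstruction_mem_masseyBracket [CharZero K] [FiniteDimensional K (HL2 ℓ)]
    {μ : HL2Section ℓ} {η : Deformation ℓ S.ε} (hη : IsPushout S.q η (eta1 μ)) (B : Lift s η) :
    (2 : K) • (B.obstruction ∘ₗ (S.quotEquiv s).toLinearMap)
      ∈ masseyBracket ℓ (1 / 2) (S.coalg s) (S.idH s) := by
  set α := brCochain S.ε η.br ∘ₗ (S.F₁Equiv s).symm.toLinearMap with hα'
  have hα : ∀ ψ, α (S.F₁Equiv s ψ) = brCochain S.ε η.br ψ := by simp [hα']
  refine ⟨α, fun φ => ?_, fun φ => ?_, fun φ => mk_lift_nu_comul₁ hα B φ⟩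
  · have h0 : (Submodule.Quotient.mk (φ : Module.Dual K (augIdeal (HarrExt.aug s))) :
        _ ⧸ (S.coalg s).F₁) = 0 := (Submodule.Quotient.mk_eq_zero _).2 φ.2
    have h1 : B.defect 0 = 0 := by
      ext x y z
      rw [B.defect_apply, map_zero]
      rfl
    have h2 : brCochain (HarrExt.aug s) B.br φ = α φ := by
      obtain ⟨ψ, rfl⟩ := (S.F₁Equiv s).surjective φ
      rw [hα, ← B.brCochain_proj]
      rfl
    rw [lift_nu_comul₁ hα B, h0, map_zero, h1, smul_zero, zero_add, smul_smul, h2, d2]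
    norm_num
  · obtain ⟨ψ, rfl⟩ := (S.F₀Equiv s).surjective φ
    have e : α (Submodule.inclusion (S.coalg s).F₀_le_F₁ (S.F₀Equiv s ψ))
        = μ.toFun (S.idH s (S.F₀Equiv s ψ)) := by
      rw [S.inclusion_F₀Equiv, hα, S.idH_F₀Equiv, ← brCochain_eta1]
      exact (brCochain_map S.q S.aug_q hη ψ).symm
    rw [← μ.mk_toFun (S.idH s (S.F₀Equiv s ψ))]
    exact ⟨e ▸ (μ.toFun _).2, congrArg _ (Subtype.ext e)⟩

end MasseyLift

section FromCochain

variable {K : Type u} [Field K] {L : Type v} [AddCommGroup L] [Module K L] {A : Type w}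
  [CommRing A] [Algebra K A] [Module.Finite K A] (ε : A →ₐ[K] K) {ℓ : LeibnizStr K L}

variable (L) in
/-- The embedding `Hom(𝔐', L) = 𝔐 ⊗ L → A ⊗ L`. -/
def augTensor : (Module.Dual K (augIdeal ε) →ₗ[K] L) →ₗ[K] A ⊗[K] L :=
  ∑ i, TensorProduct.mk K A L (Module.Free.chooseBasis K (augIdeal ε) i)
    ∘ₗ LinearMap.applyₗ ((Module.Free.chooseBasis K (augIdeal ε)).coord i)

theorem augMap_augTensor (f : Module.Dual K (augIdeal ε) →ₗ[K] L) :
    augMap L ε (augTensor L ε f) = 0 := by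
  have h (i) : ε (Module.Free.chooseBasis K (augIdeal ε) i : A) = 0 :=
    mem_augIdeal.1 (Module.Free.chooseBasis K (augIdeal ε) i).2
  simp [augTensor, h]

theorem evalAug_augTensor (f : Module.Dual K (augIdeal ε) →ₗ[K] L)
    (φ : Module.Dual K (augIdeal ε)) : evalAug L ε φ (augTensor L ε f) = f φ := by
  have h := congrArg f ((Module.Free.chooseBasis K (augIdeal ε)).sum_dual_apply_smul_coord φ)
  rw [map_sum] at h
  simp only [map_smul] at h
  rw [← h]
  simp [augTensor, evalAug_tmul, augSplit_coe]

/-- The bilinear operation on `A ⊗ L` with `[1 ⊗ x, 1 ⊗ y] = 1 ⊗ [x, y] + α(x, y)`, where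
`α(x, y)` is regarded as an element of `Hom(𝔐', L) = 𝔐 ⊗ L`. -/
def cochainBr (ℓ : LeibnizStr K L) (α : Module.Dual K (augIdeal ε) →ₗ[K] CL2 K L) :
    A ⊗[K] L →ₗ[A] A ⊗[K] L →ₗ[A] A ⊗[K] L :=
  extBr (LinearMap.mk₂ K (fun x y => (1 : A) ⊗ₜ ℓ.br x y
      + augTensor L ε (LinearMap.applyₗ y ∘ₗ LinearMap.applyₗ x ∘ₗ α))
    (fun x x' y => by
      rw [map_add, LinearMap.add_apply, TensorProduct.tmul_add, add_add_add_comm, ← map_add]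
      congr 2
      ext
      simp)
    (fun c x y => by
      rw [map_smul, LinearMap.smul_apply, TensorProduct.tmul_smul, smul_add, ← map_smul]
      congr 2
      ext
      simp)
    (fun x y y' => by
      rw [map_add, TensorProduct.tmul_add, add_add_add_comm, ← map_add]
      congr 2
      ext
      simp)
    (fun c x y => by
      rw [map_smul, TensorProduct.tmul_smul, smul_add, ← map_smul]
      congr 2
      ext
      simp))

theorem cochainBr_one (α : Module.Dual K (augIdeal ε) →ₗ[K] CL2 K L) (x y : L) :
    cochainBr ε ℓ α (1 ⊗ₜ x) (1 ⊗ₜ y) = (1 : A) ⊗ₜ ℓ.br x y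
      + augTensor L ε (LinearMap.applyₗ y ∘ₗ LinearMap.applyₗ x ∘ₗ α) := by
  rw [cochainBr, extBr_tmul, mul_one, one_smul]
  rfl

theorem augMap_cochainBr_one (α : Module.Dual K (augIdeal ε) →ₗ[K] CL2 K L) (x y : L) :
    augMap L ε (cochainBr ε ℓ α (1 ⊗ₜ x) (1 ⊗ₜ y)) = ℓ.br x y := by
  rw [cochainBr_one, map_add, augMap_augTensor, add_zero, augMap_tmul, map_one, one_smul]

theorem brCochain_cochainBr (α : Module.Dual K (augIdeal ε) →ₗ[K] CL2 K L) :
    brCochain ε (cochainBr ε ℓ α) = α := by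
  ext φ x y
  rw [brCochain_apply, cochainBr_one, map_add, evalAug_one_tmul, zero_add, evalAug_augTensor]
  rfl

/-- A cochain satisfying the Maurer-Cartan equation defines a deformation. -/
theorem exists_deformation [CharZero K] (α : Module.Dual K (augIdeal ε) →ₗ[K] CL2 K L)
    (hα : ∀ φ, (2 : K) • δ2 ℓ (α φ)
      = TensorProduct.lift (nu K L) (TensorProduct.map α α (augComul ε φ))) :
    ∃ η : Deformation ℓ ε, brCochain ε η.br = α := by
  have hbr := augMap_br_of_one ε _ (augMap_cochainBr_one (ℓ := ℓ) ε α)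
  refine ⟨⟨⟨cochainBr ε ℓ α, fun u v w => ?_⟩, hbr⟩, brCochain_cochainBr ε α⟩
  refine (sub_eq_zero.1 (jac_eq_zero (cochainBr ε ℓ α) (fun x y z => ?_) u v w)).symm
  apply eq_of_evalAug ε
  · rw [jac, map_sub, map_sub, hbr, hbr, hbr, hbr, hbr, hbr, ℓ.leibniz, map_zero, sub_self]
  · intro φ
    apply smul_right_injective L (two_ne_zero : (2 : K) ≠ 0)
    refine (two_smul_evalAug_jac ε (augMap_cochainBr_one ε α) φ x y z).trans ?_
    rw [brCochain_cochainBr, ← hα, map_zero]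
    exact (sub_self _).trans (smul_zero _).symm

end FromCochain

section Gauge

variable {K : Type u} [Field K] {L : Type v} [AddCommGroup L] [Module K L] {A : Type w}
  [CommRing A] [Algebra K A] (ε : A →ₐ[K] K) {ℓ : LeibnizStr K L}

theorem sub_augMap_mem (t : A ⊗[K] L) :
    t - (1 : A) ⊗ₜ augMap L ε t ∈ RingHom.ker ε • (⊤ : Submodule A (A ⊗[K] L)) := by
  induction t with
  | zero => simp
  | add a b ha hb =>
    rw [map_add, TensorProduct.tmul_add, add_sub_add_comm]
    exact add_mem ha hb
  | tmul a x =>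
    have : a ⊗ₜ[K] x - (1 : A) ⊗ₜ augMap L ε (a ⊗ₜ x)
        = (a - algebraMap K A (ε a)) • ((1 : A) ⊗ₜ[K] x) := by
      rw [augMap_tmul, sub_smul, ← tmul_eq_smul, algebraMap_smul, TensorProduct.tmul_smul]
    rw [this]
    exact Submodule.smul_mem_smul (by simp [RingHom.mem_ker]) trivial

theorem isNilpotent_ker_aug [IsLocalRing A] [Module.Finite K A] :
    IsNilpotent (RingHom.ker ε) := by
  have : IsArtinianRing A := IsArtinianRing.of_finite K A
  have h := IsArtinianRing.isNilpotent_jacobson_bot (R := A)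
  rw [IsLocalRing.jacobson_eq_maximalIdeal ⊥ bot_ne_top] at h
  have hε : Function.Surjective ε := fun c => ⟨algebraMap K A c, ε.commutes c⟩
  have : (RingHom.ker ε).IsMaximal := RingHom.ker_isMaximal_of_surjective ε hε
  rwa [IsLocalRing.eq_maximalIdeal this]

variable {n : L →ₗ[K] A ⊗[K] L}

theorem augMap_liftBaseChange (hn : ∀ x, augMap L ε (n x) = 0) (t : A ⊗[K] L) :
    augMap L ε (n.liftBaseChange A t) = 0 := by
  induction t with
  | zero => simp
  | add a b ha hb => rw [map_add, map_add, ha, hb, add_zero]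
  | tmul a x => rw [LinearMap.liftBaseChange_tmul, augMap_smul, hn, smul_zero]

theorem isNilpotent_liftBaseChange [IsLocalRing A] [Module.Finite K A]
    (hn : ∀ x, augMap L ε (n x) = 0) :
    IsNilpotent (n.liftBaseChange A : Module.End A (A ⊗[K] L)) := by
  obtain ⟨k, hk⟩ := isNilpotent_ker_aug ε
  refine ⟨k, ?_⟩
  have key : ∀ j : ℕ, LinearMap.range ((n.liftBaseChange A : Module.End A (A ⊗[K] L)) ^ j)
      ≤ RingHom.ker ε ^ j • (⊤ : Submodule A (A ⊗[K] L)) := by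
    intro j
    induction j with
    | zero => simp
    | succ j ih =>
      rw [pow_succ', pow_succ, Module.End.mul_eq_comp, LinearMap.range_comp]
      refine (Submodule.map_mono ih).trans ?_
      rw [Submodule.map_smul'', mul_smul]
      refine Submodule.smul_mono le_rfl ?_
      rintro _ ⟨t, -, rfl⟩
      have := sub_augMap_mem ε (n.liftBaseChange A t)
      rwa [augMap_liftBaseChange ε hn, TensorProduct.tmul_zero, sub_zero] at this
  have h := key k
  rwa [hk, Submodule.zero_eq_bot, Submodule.bot_smul, le_bot_iff, LinearMap.range_eq_bot] at h

/-- The transport of a bilinear operation along an automorphism. -/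
def conjBr {V : Type*} [AddCommGroup V] [Module A V] (g : V ≃ₗ[A] V) (br : V →ₗ[A] V →ₗ[A] V) :
    V →ₗ[A] V →ₗ[A] V :=
  (br.compl₁₂ g.symm.toLinearMap g.symm.toLinearMap).compr₂ g.toLinearMap

theorem conjBr_apply {V : Type*} [AddCommGroup V] [Module A V] (g : V ≃ₗ[A] V)
    (br : V →ₗ[A] V →ₗ[A] V) (u v : V) : conjBr g br u v = g (br (g.symm u) (g.symm v)) := rfl

theorem jac_conjBr {V : Type*} [AddCommGroup V] [Module A V] (g : V ≃ₗ[A] V)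
    (br : V →ₗ[A] V →ₗ[A] V) (u v w : V) :
    jac (conjBr g br) u v w = g (jac br (g.symm u) (g.symm v) (g.symm w)) := by
  simp [jac, conjBr_apply]

variable [Module.Finite K A]

theorem evalAug_smul_of_primitive {φ : Module.Dual K (augIdeal ε)} (hφ : augComul ε φ = 0) (a : A)
    (t : A ⊗[K] L) : evalAug L ε φ (a • t)
      = ε a • evalAug L ε φ t + φ (augSplit ε a) • augMap L ε t := by
  rw [evalAug_smul, hφ, map_zero, add_zero]

theorem evalAug_liftBaseChange_of_primitive (hn : ∀ x, augMap L ε (n x) = 0)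
    {φ : Module.Dual K (augIdeal ε)} (hφ : augComul ε φ = 0) (t : A ⊗[K] L) :
    evalAug L ε φ (n.liftBaseChange A t) = evalAug L ε φ (n (augMap L ε t)) := by
  induction t with
  | zero => simp
  | add a b ha hb => simp only [map_add, ha, hb]
  | tmul a x =>
    rw [LinearMap.liftBaseChange_tmul, evalAug_smul_of_primitive ε hφ, hn, smul_zero, add_zero,
      augMap_tmul, map_smul, map_smul]

theorem evalAug_br_of_primitive (η : Deformation ℓ ε) {φ : Module.Dual K (augIdeal ε)}
    (hφ : augComul ε φ = 0) (u v : A ⊗[K] L) :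
    evalAug L ε φ (η.br u v) = brCochain ε η.br φ (augMap L ε u) (augMap L ε v)
      + ℓ.br (evalAug L ε φ u) (augMap L ε v) + ℓ.br (augMap L ε u) (evalAug L ε φ v) := by
  induction u with
  | zero => simp
  | add a b ha hb => simp only [map_add, LinearMap.add_apply, ha, hb]; abel
  | tmul a x =>
    rw [tmul_eq_smul a x, LinearMap.map_smul η.br, LinearMap.smul_apply,
      evalAug_smul_of_primitive ε hφ, η.augMap_br, ← tmul_eq_smul,
      evalAug_br_left ε η.augMap_br_one, hφ, map_zero, add_zero, evalAug_tmul, augMap_tmul,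
      augMap_tmul, map_one, one_smul]
    simp only [map_smul, LinearMap.smul_apply, smul_add]
    abel

variable [IsLocalRing A]

/-- The automorphism `1 ⊗ x ↦ 1 ⊗ x + n(x)` of `A ⊗ L`. -/
def gauge (hn : ∀ x, augMap L ε (n x) = 0) : A ⊗[K] L ≃ₗ[A] A ⊗[K] L :=
  LinearEquiv.ofBijective (1 + n.liftBaseChange A : Module.End A (A ⊗[K] L))
    ((Module.End.isUnit_iff _).1 (isNilpotent_liftBaseChange ε hn).isUnit_one_add)

theorem gauge_apply (hn : ∀ x, augMap L ε (n x) = 0) (t : A ⊗[K] L) :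
    gauge ε hn t = t + n.liftBaseChange A t := rfl

theorem augMap_gauge (hn : ∀ x, augMap L ε (n x) = 0) (t : A ⊗[K] L) : augMap L ε (gauge ε hn t) = augMap L ε t := by
  rw [gauge_apply, map_add, augMap_liftBaseChange ε hn, add_zero]

theorem augMap_gauge_symm (hn : ∀ x, augMap L ε (n x) = 0) (t : A ⊗[K] L) :
    augMap L ε ((gauge ε hn).symm t) = augMap L ε t := by
  rw [← augMap_gauge ε hn, LinearEquiv.apply_symm_apply]

/-- The deformation isomorphic to `η` by means of the automorphism `gauge`. -/
def Deformation.conj (hn : ∀ x, augMap L ε (n x) = 0) (η : Deformation ℓ ε) :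
    Deformation ℓ ε where
  br := conjBr (gauge ε hn) η.br
  leibniz x y z := by simp [conjBr_apply, η.leibniz]
  augMap_br x y := by
    rw [conjBr_apply, augMap_gauge, η.augMap_br, augMap_gauge_symm, augMap_gauge_symm]

theorem brCochain_conj (hn : ∀ x, augMap L ε (n x) = 0) (η : Deformation ℓ ε) {φ : Module.Dual K (augIdeal ε)}
    (hφ : augComul ε φ = 0) {γ : CL1 K L} (hγ : ∀ x, evalAug L ε φ (n x) = γ x) :
    brCochain ε (η.conj ε hn).br φ = brCochain ε η.br φ - δ1 ℓ γ := by
  ext x y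
  have h1 : (η.conj ε hn).br (gauge ε hn (1 ⊗ₜ x)) (gauge ε hn (1 ⊗ₜ y))
      = gauge ε hn (η.br (1 ⊗ₜ x) (1 ⊗ₜ y)) := by
    change gauge ε hn (η.br _ _) = _
    simp
  have h2 := congrArg (evalAug L ε φ) h1
  have hg (t : A ⊗[K] L) : evalAug L ε φ (gauge ε hn t)
      = evalAug L ε φ t + γ (augMap L ε t) := by
    rw [gauge_apply, map_add, evalAug_liftBaseChange_of_primitive ε hn hφ, hγ]
  rw [evalAug_br_of_primitive ε _ hφ, augMap_gauge, augMap_gauge, hg, hg, hg, η.augMap_br_one,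
    evalAug_one_tmul, evalAug_one_tmul, augMap_tmul, augMap_tmul, map_one, one_smul, one_smul,
    zero_add, zero_add] at h2
  rw [LinearMap.sub_apply, LinearMap.sub_apply, δ1_apply, brCochain_apply ε η.br]
  rw [← sub_eq_iff_eq_add] at h2
  rw [← h2]
  abel

end Gauge

section GaugeLift

variable {K : Type u} [Field K] {L : Type v} [AddCommGroup L] [Module K L] {A : Type w}
  [CommRing A] [Algebra K A] [IsLocalRing A] [Module.Finite K A] {ε : A →ₐ[K] K}
  {ℓ : LeibnizStr K L}

theorem exists_lift_conj (s : HarrSection ε) {n : L →ₗ[K] A ⊗[K] L}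
    (hn : ∀ x, augMap L ε (n x) = 0) {η : Deformation ℓ ε} (B : Lift s η) :
    ∃ B' : Lift s (η.conj ε hn), B'.obstruction = B.obstruction := by
  obtain ⟨σ, hσ⟩ := (HarrExt.proj s).toLinearMap.exists_rightInverse_of_surjective
    (LinearMap.range_eq_top.2 (HarrExt.proj_surjective s))
  have hp (x : L) : (HarrExt.proj s).toLinearMap.rTensor L ((σ.rTensor L ∘ₗ n) x) = n x := by
    rw [LinearMap.comp_apply, ← LinearMap.comp_apply, ← LinearMap.rTensor_comp, hσ,
      LinearMap.rTensor_id_apply]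
  have hn' (x : L) : augMap L (HarrExt.aug s) ((σ.rTensor L ∘ₗ n) x) = 0 := by
    rw [augMap_aug, hp, hn]
  have hl (t : HarrExt s ⊗[K] L) : (HarrExt.proj s).toLinearMap.rTensor L
      ((σ.rTensor L ∘ₗ n).liftBaseChange (HarrExt s) t)
        = n.liftBaseChange A ((HarrExt.proj s).toLinearMap.rTensor L t) := by
    induction t with
    | zero => simp
    | add a b ha hb => simp only [map_add, ha, hb]
    | tmul a x =>
      rw [LinearMap.liftBaseChange_tmul, rTensor_algHom_smul, hp, LinearMap.rTensor_tmul,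
        LinearMap.liftBaseChange_tmul]
      rfl
  have hg (t : HarrExt s ⊗[K] L) : (HarrExt.proj s).toLinearMap.rTensor L
      (gauge (HarrExt.aug s) hn' t) = gauge ε hn ((HarrExt.proj s).toLinearMap.rTensor L t) := by
    rw [gauge_apply, gauge_apply, map_add, hl]
  have hg' (t : HarrExt s ⊗[K] L) : (HarrExt.proj s).toLinearMap.rTensor L
      ((gauge (HarrExt.aug s) hn').symm t)
        = (gauge ε hn).symm ((HarrExt.proj s).toLinearMap.rTensor L t) := by
    rw [LinearEquiv.eq_symm_apply, ← hg, LinearEquiv.apply_symm_apply]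
  have he (h : H2Harr ε) {t : HarrExt s ⊗[K] L}
      (ht : (HarrExt.proj s).toLinearMap.rTensor L t = 0) :
      evalMap L s h (gauge (HarrExt.aug s) hn' t) = evalMap L s h t := by
    obtain ⟨t, rfl⟩ := exists_incl ht
    clear ht
    induction t with
    | zero => simp
    | add a b ha hb => simp only [map_add, ha, hb]
    | tmul m x =>
      rw [gauge_apply, LinearMap.rTensor_tmul, LinearMap.liftBaseChange_tmul,
        HarrExt.incl_smul, hn', TensorProduct.tmul_zero, add_zero]
  refine ⟨⟨conjBr (gauge (HarrExt.aug s) hn') B.br, fun u v => ?_⟩, ?_⟩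
  · rw [conjBr_apply, hg, B.proj_br, hg', hg']
    rfl
  · ext1 h
    refine congrArg (HL3.mk ℓ) (Subtype.ext ?_)
    ext x y z
    rw [Lift.defect_apply, Lift.defect_apply, jac_conjBr, he h (B.proj_jac _ _ _),
      B.evalMap_jac_1, B.evalMap_jac_2, B.evalMap_jac_3]
    simp only [augMap_gauge_symm, augMap_tmul, map_one, one_smul]

end GaugeLift

section Converse

variable {K : Type u} [Field K] {L : Type v} [AddCommGroup L] [Module K L] {ℓ : LeibnizStr K L}
  {S : Stage ℓ} {s : HarrSection S.ε}

theorem Stage.comul₁_F₁Equiv (ψ : Module.Dual K (augIdeal S.ε)) :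
    (S.coalg s).comul₁ (S.F₁Equiv s ψ)
      = TensorProduct.map (S.F₁Equiv s).toLinearMap (S.F₁Equiv s).toLinearMap
          (augComul S.ε ψ) := by
  apply map_subtype_injective
  rw [FiltCoalg.map_comul₁, ← LinearMap.comp_apply, ← TensorProduct.map_comp]
  change augComul (HarrExt.aug s) ((projIdeal s).dualMap ψ)
    = TensorProduct.map (projIdeal s).dualMap (projIdeal s).dualMap (augComul S.ε ψ)
  apply tensor_ext
  intro x y
  rw [dualDistrib_map, dualDistrib_dualComul, dualDistrib_dualComul]
  rfl

theorem Stage.augComul_qIdeal (ψ : Module.Dual K (augIdeal (augC1 ℓ))) :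
    augComul S.ε (S.qIdeal.dualMap ψ) = 0 := by
  apply tensor_ext
  intro x y
  rw [dualDistrib_dualComul, map_zero, LinearMap.zero_apply, LinearMap.dualMap_apply]
  have : S.qIdeal (augIdealMul S.ε x y) = 0 := by
    apply Subtype.ext
    refine (map_mul S.q (x : S.C) (y : S.C)).trans ?_
    exact augSqZero_mul _ _ (S.qIdeal x).2 (S.qIdeal y).2
  rw [this, map_zero]

theorem HL2.sub_mem_range_of_mk_eq {a b : LinearMap.ker (δ2 ℓ)} (h : HL2.mk ℓ a = HL2.mk ℓ b) :
    (a - b : CL2 K L) ∈ LinearMap.range (δ1 ℓ) :=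
  (Submodule.Quotient.eq ((LinearMap.range (δ1 ℓ)).submoduleOf (LinearMap.ker (δ2 ℓ)))).1 h

theorem isPushout_of_brCochain [FiniteDimensional K (HL2 ℓ)] {μ : HL2Section ℓ}
    {η : Deformation ℓ S.ε} (h : ∀ ψ, brCochain S.ε η.br (S.qIdeal.dualMap ψ)
      = brCochain (augC1 ℓ) (eta1 μ).br ψ) : IsPushout S.q η (eta1 μ) := by
  intro x y
  apply eq_of_evalAug (augC1 ℓ)
  · rw [(eta1 μ).augMap_br_one, augMap_rTensor S.ε S.q S.aug_q, η.augMap_br_one]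
  · intro ψ
    rw [evalAug_rTensor S.ε S.q S.aug_q]
    exact (LinearMap.congr_fun (LinearMap.congr_fun (h ψ) x) y).symm

theorem exists_deformation_of_mem_masseyBracket [CharZero K] [FiniteDimensional K (HL2 ℓ)]
    (μ : HL2Section ℓ) {b : Module.Dual K (augIdeal (HarrExt.aug s)) ⧸ (S.coalg s).F₁ →ₗ[K] HL3 ℓ}
    (hb : b ∈ masseyBracket ℓ (1 / 2) (S.coalg s) (S.idH s)) :
    ∃ η : Deformation ℓ S.ε, IsPushout S.q η (eta1 μ) ∧
      ∀ B : Lift s η, b = (2 : K) • (B.obstruction ∘ₗ (S.quotEquiv s).toLinearMap) := by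
  obtain ⟨α, hα, hα₀, hα₃⟩ := hb
  obtain ⟨η, hη⟩ := exists_deformation (ℓ := ℓ) S.ε (α ∘ₗ (S.F₁Equiv s).toLinearMap) (by
    intro ψ
    have h := hα (S.F₁Equiv s ψ)
    rw [Stage.comul₁_F₁Equiv, ← LinearMap.comp_apply (TensorProduct.map _ _),
      ← TensorProduct.map_comp] at h
    have h2 : δ2 ℓ (α (S.F₁Equiv s ψ)) = d2 ℓ (α (S.F₁Equiv s ψ)) := by
      simp [d2]
    rw [LinearMap.comp_apply, LinearEquiv.coe_coe, h2, h, smul_smul]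
    norm_num)
  have hηα (ψ) : α (S.F₁Equiv s ψ) = brCochain S.ε η.br ψ := by rw [hη]; rfl
  have hrange (ψ : Module.Dual K (augIdeal (augC1 ℓ))) :
      brCochain S.ε η.br (S.qIdeal.dualMap ψ) - brCochain (augC1 ℓ) (eta1 μ).br ψ
        ∈ LinearMap.range (δ1 ℓ) := by
    obtain ⟨h, e⟩ := hα₀ (S.F₀Equiv s ψ)
    rw [← μ.mk_toFun (S.idH s (S.F₀Equiv s ψ))] at e
    have := HL2.sub_mem_range_of_mk_eq e
    simp only [S.inclusion_F₀Equiv, hηα, S.idH_F₀Equiv] at this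
    rwa [← brCochain_eta1] at this
  obtain ⟨σ, hσ⟩ := (δ1 ℓ).rangeRestrict.exists_rightInverse_of_surjective (δ1 ℓ).range_rangeRestrict
  obtain ⟨r, hr⟩ := S.qIdeal.dualMap.exists_leftInverse_of_injective
    (LinearMap.ker_eq_bot.2 (LinearMap.dualMap_injective_of_surjective S.qIdeal_surjective))
  let γ : Module.Dual K (augIdeal (augC1 ℓ)) →ₗ[K] CL1 K L :=
    σ ∘ₗ LinearMap.codRestrict _ (brCochain S.ε η.br ∘ₗ S.qIdeal.dualMap
      - brCochain (augC1 ℓ) (eta1 μ).br) hrange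
  have hγ (ψ) : δ1 ℓ (γ ψ) = brCochain S.ε η.br (S.qIdeal.dualMap ψ)
      - brCochain (augC1 ℓ) (eta1 μ).br ψ :=
    congrArg Subtype.val (LinearMap.congr_fun hσ _)
  let n : L →ₗ[K] S.C ⊗[K] L := augTensor L S.ε ∘ₗ (γ ∘ₗ r).flip
  have hn (x : L) : augMap L S.ε (n x) = 0 := augMap_augTensor _ _
  refine ⟨η.conj S.ε hn, isPushout_of_brCochain fun ψ => ?_, fun B => ?_⟩
  · rw [brCochain_conj S.ε hn η (S.augComul_qIdeal ψ) (γ := γ ψ), hγ, sub_sub_cancel]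
    intro x
    refine (evalAug_augTensor _ _ _).trans ?_
    change γ (r (S.qIdeal.dualMap ψ)) x = _
    rw [← LinearMap.comp_apply r, hr, LinearMap.id_apply]
  · obtain ⟨B', hB'⟩ := exists_lift_conj s hn (Lift.std s η)
    rw [obstruction_eq B B', hB']
    apply LinearMap.ext
    intro φ
    obtain ⟨φ, rfl⟩ := Submodule.Quotient.mk_surjective _ φ
    obtain ⟨h, e⟩ := hα₃ φ
    obtain ⟨_, e'⟩ := mk_lift_nu_comul₁ hηα (Lift.std s η) φ
    exact e.symm.trans e'

end Converse

section Rescaling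

variable {K : Type u} [Field K] {L : Type v} [AddCommGroup L] [Module K L] {ℓ : LeibnizStr K L}

/-- Rescaling the cochain of a Massey bracket. -/
theorem smul_mem_masseyBracket {F : Type w} [AddCommGroup F] [Module K F] {Q : FiltCoalg K F}
    {a : Q.F₀ →ₗ[K] HL2 ℓ} {b : F ⧸ Q.F₁ →ₗ[K] HL3 ℓ} {c c' r : K} (hr : c = c' * r)
    (hb : b ∈ masseyBracket ℓ c Q a) : (r ^ 2) • b ∈ masseyBracket ℓ c' Q (r • a) := by
  obtain ⟨α, h1, h2, h3⟩ := hb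
  have e (φ : F) : TensorProduct.lift (nu K L) (TensorProduct.map (r • α) (r • α) (Q.comul₁ φ))
      = (r ^ 2) • TensorProduct.lift (nu K L) (TensorProduct.map α α (Q.comul₁ φ)) := by
    rw [TensorProduct.map_smul_left, TensorProduct.map_smul_right, smul_smul, ← sq,
      LinearMap.smul_apply, map_smul]
  refine ⟨r • α, fun φ => ?_, fun φ => ?_, fun φ => ?_⟩
  · rw [e, LinearMap.smul_apply, map_smul, h1, smul_smul, smul_smul, hr]
    congr 1
    ring
  · obtain ⟨h, h'⟩ := h2 φ
    refine ⟨Submodule.smul_mem _ r h, ?_⟩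
    rw [LinearMap.smul_apply r a, ← h']
    exact map_smul (HL2.mk ℓ) r ⟨_, h⟩
  · obtain ⟨h, h'⟩ := h3 φ
    refine ⟨e φ ▸ Submodule.smul_mem _ (r ^ 2) h, ?_⟩
    rw [LinearMap.smul_apply, ← h']
    exact (congrArg (HL3.mk ℓ) (Subtype.ext (e φ))).trans (map_smul (HL3.mk ℓ) (r ^ 2) ⟨_, h⟩)

end Rescaling

end LeibnizDeformation

end

open LeibnizDeformation in
theorem mainTheorem3 {K : Type u} [Field K] [CharZero K] {L : Type v} [AddCommGroup L] [Module K L]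
    (ℓ : LeibnizStr K L) [FiniteDimensional K (HL2 ℓ)] (μ : HL2Section ℓ)
    (k : ℕ) (S : Stage ℓ) (hS : IsStage μ k S) (s : HarrSection S.ε) :
    (∀ B : Lift s S.η,
      (2 : K) • (B.obstruction ∘ₗ (S.quotEquiv s).toLinearMap)
        ∈ masseyBracket ℓ (1 / 2) (S.coalg s) (S.idH s)) ∧
    (∀ b ∈ masseyBracket ℓ (1 / 2) (S.coalg s) (S.idH s),
      ∃ η : Deformation ℓ S.ε, IsPushout S.q η (eta1 μ) ∧
        ∀ B : Lift s η, b = (2 : K) • (B.obstruction ∘ₗ (S.quotEquiv s).toLinearMap)) ∧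
    (∀ B : Lift s S.η,
      (1 / 2 : K) • (B.obstruction ∘ₗ (S.quotEquiv s).toLinearMap)
        ∈ masseyBracket ℓ 1 (S.coalg s) ((1 / 2 : K) • S.idH s)) ∧
    (∀ b ∈ masseyBracket ℓ 1 (S.coalg s) ((1 / 2 : K) • S.idH s),
      ∃ η : Deformation ℓ S.ε, IsPushout S.q η (eta1 μ) ∧
        ∀ B : Lift s η, b = (1 / 2 : K) • (B.obstruction ∘ₗ (S.quotEquiv s).toLinearMap)) := by
  have key : ∀ {c c' r : K} {a a' : (S.coalg s).F₀ →ₗ[K] HL2 ℓ}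
      {b b' : Module.Dual K (augIdeal (HarrExt.aug s)) ⧸ (S.coalg s).F₁ →ₗ[K] HL3 ℓ},
      c = c' * r → r • a = a' → (r ^ 2) • b = b' → b ∈ masseyBracket ℓ c (S.coalg s) a →
        b' ∈ masseyBracket ℓ c' (S.coalg s) a' := by
    rintro c c' r a _ b _ hr rfl rfl hb
    exact smul_mem_masseyBracket hr hb
  refine ⟨obstruction_mem_masseyBracket (isPushout_of_isStage hS),
    fun b hb => exists_deformation_of_mem_masseyBracket μ hb, fun B => ?_, fun b hb => ?_⟩
  · refine key (r := 1 / 2) (by norm_num) rfl ?_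
      (obstruction_mem_masseyBracket (isPushout_of_isStage hS) B)
    rw [smul_smul]
    norm_num
  · obtain ⟨η, hη, h⟩ := exists_deformation_of_mem_masseyBracket μ
      (key (c' := 1 / 2) (r := 2) (a' := S.idH s) (by norm_num)
        (by rw [smul_smul]; norm_num) rfl hb)
    refine ⟨η, hη, fun B => ?_⟩
    apply smul_right_injective _ (by norm_num : (2 : K) ^ 2 ≠ 0)
    refine (h B).trans ?_
    simp only [smul_smul]
    norm_num
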